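/- **Model.** A downlink network in $\mathbb R^2$ has a finite set $\mathcal S$ of seller operators and a finite set $\mathcal B$ of buyer operators. Seller $s$ owns a finite set $\mathcal L_s$ of sub-bands, disjoint from those of the other sellers; sub-band $l_s\in\mathcal L_s$ is used by a set $Q_{l_s}$ of operators with $s\in Q_{l_s}$ and $Q_{l_s}\setminus\{s\}\subseteq\mathcal B$. Fix a path loss exponent $\alpha>2$, a noise power $\sigma^2\ge 0$, a transmit power $P^{\rm S}>0$ of the base stations (BSs) of sellers, intensities $\lambda_k,\mu_k>0$ for every operator $k$, and thresholds $\zeta_s>0$ for every seller $s$. The BSs of operator $k$ form a homogeneous Poisson process $\Phi_k$ of intensity $\lambda_k$, and the users of $s$ one, $\Psi_s$, of intensity $\mu_s$. All channel gains are exponential with mean $1$. On $l_s$ the maximum allowable power of a buyer BS at a point $x$ is $$P^{\rm B}_{l_s}=\zeta_s/H^{\rm B}_{l_s},\qquad H^{\rm B}_{l_s}=\max_{y_i\in\Psi_s}h_i\|x-y_i\|^{-\alpha},$$ with independent gains $h_i$, independent of $\Psi_s$ (its law does not depend on $x$). The buyer BSs carry transmit powers on $l_s$ with this law. The processes $\Phi_k$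 ($k\in Q_{l_s}$), the gains from their BSs to the typical user, and the transmit powers of the individual buyer BSs are all independent. The typical user of seller $s$ is at the origin and is served by the BS of $s$ with the largest average received power, at distance $x_0$, with gain $h_0$. Its SINR on $l_s$ is $$\gamma_{s,l_s}^{\rm S}=\frac{P^{\rm S}h_0x_0^{-\alpha}}{I+\sigma^2},\qquad I=\sum_{f}P^{\rm S}h_fx_f^{-\alpha}+\sum_{b\in Q_{l_s}\setminus\{s\}}\ \sum_{g\in\Phi_b}P_g h_g x_g^{-\alpha},$$ where $f$ runs over the BSs of $s$ other than the serving one, $x_f,x_g$ are distances to the origin, $h_f,h_g$ are gains, and $P_g$ is the transmit power of the buyer BS $g$. **Theorem 2.** Let $\beta>0$. Then $\mathbb E[(P^{\rm B}_{l_s})^{2/\alpha}]<\infty$, $I<\infty$ almost surely, and the coverage probability of the typical user of $s$ on $l_s$, that is, the expectation over the transmit powers of the buyer BSs of the conditional probability of $\gamma^{\rm S}_{s,l_s}>\beta$ given these powers, is $$\mathcal C_{s,l_s}^{\rm S}=\int_0^\infty \pi\lambda_s (P^{\rm S})^{2/\alpha}\,e^{-\beta\sigma^2z^{\alpha/2}}\,e^{-\pi\lambda_s(P^{\rm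 S})^{2/\alpha}z}\,\mathcal L\big(\beta z^{\alpha/2}\big)\,dz ,$$ a convergent integral, where, with $\lambda_{s,l_s}=\sum_{b\in Q_{l_s}\setminus\{s\}}\lambda_b$, $\rho(\alpha,\beta)=\int_{\beta^{-2/\alpha}}^\infty\frac{d\nu}{1+\nu^{\alpha/2}}$ and $\rho(\alpha,\infty)=\int_0^\infty\frac{d\nu}{1+\nu^{\alpha/2}}$, $$\mathcal L(\kappa)=\exp\!\big(-\pi\lambda_s(P^{\rm S})^{2/\alpha}\kappa^{2/\alpha}\rho(\alpha,\beta)\big)\,\exp\!\big(-\pi\lambda_{s,l_s}\,\mathbb E[(P^{\rm B}_{l_s})^{2/\alpha}]\,\kappa^{2/\alpha}\rho(\alpha,\infty)\big).$$ Moreover $\mathcal L(\beta z^{\alpha/2})$ is the Laplace transform of the interference at $\beta z^{\alpha/2}$ given the serving distance, where $z=x_0^2/(P^{\rm S})^{2/\alpha}$: almost surely, $\mathbb E\big[e^{-\kappa I}\,\big|\,x_0\big]=\mathcal L(\kappa)$ with $\kappa=\beta z^{\alpha/2}=\beta x_0^\alpha/P^{\rm S}$. -/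

import Mathlib

open MeasureTheory ProbabilityTheory Set
open scoped ENNReal NNReal

namespace SpectrumSharing

noncomputable section

/-- The plane in which base stations (BSs) and user equipments (UEs) live, with the Euclidean
norm and Lebesgue measure. -/
abbrev Plane : Type := EuclideanSpace ℝ (Fin 2)

/-- The number of points of the enumerated point configuration `X 0 ω, X 1 ω, …` that lie
in `A`. -/
def count {Ω : Type*} (X : ℕ → Ω → Plane) (A : Set Plane) (ω : Ω) : ℕ∞ :=
  {n : ℕ | X n ω ∈ A}.encard

/-- `X 0, X 1, …` is a (measurable) enumeration of the points of a homogeneous Poisson point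
process of intensity `lam` on the plane: the number of points in a Borel set `A` of finite area is
Poisson with mean `lam * area A`, and the numbers of points in disjoint sets are independent.
(For `lam > 0` such a process has infinitely many points, so that it is enumerated by `ℕ`.) -/
structure IsPoissonProcess {Ω : Type*} [MeasurableSpace Ω] (P : Measure Ω)
    (X : ℕ → Ω → Plane) (lam : ℝ) : Prop where
  measurable : ∀ n, Measurable (X n)
  count_law : ∀ A : Set Plane, MeasurableSet A → volume A < ∞ → ∀ j : ℕ,
    P {ω | count X A ω = j} = poissonMeasure (lam * (volume A).toReal).toNNReal {j}
  count_indep : ∀ (m : ℕ) (A : Fin m → Set Plane), (∀ i, MeasurableSet (A i)) →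
    (∀ i, volume (A i) < ∞) → Pairwise (fun i j => Disjoint (A i) (A j)) →
    iIndepFun (fun i => count X (A i)) P

/-- The deterministic data of the network: seller and buyer operators (MNOs), licensed sub-bands
of the sellers, sharing groups, intensities, thresholds, and the physical constants. -/
structure Network (MNO Band : Type*) [DecidableEq MNO] where
  /-- seller MNOs -/
  sellers : Finset MNO
  /-- buyer MNOs -/
  buyers : Finset MNO
  /-- licensed sub-bands of a seller -/
  bands : MNO → Finset Band
  /-- the MNOs sharing a given sub-band, its owner included -/
  group : Band → Finset MNO
  /-- intensity of the BSs of an MNO -/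
  bsIntensity : MNO → ℝ
  /-- intensity of the UEs of an MNO -/
  ueIntensity : MNO → ℝ
  /-- maximum interference threshold of a seller -/
  threshold : MNO → ℝ
  /-- the fixed transmit power of the BSs of sellers -/
  sellerPower : ℝ
  /-- path loss exponent -/
  α : ℝ
  /-- the noise power is `σ ^ 2` -/
  σ : ℝ
  bands_disjoint : ∀ s ∈ sellers, ∀ t ∈ sellers, s ≠ t → Disjoint (bands s) (bands t)
  seller_mem_group : ∀ s ∈ sellers, ∀ l ∈ bands s, s ∈ group l
  group_subset : ∀ s ∈ sellers, ∀ l ∈ bands s, (group l).erase s ⊆ buyers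
  bsIntensity_pos : ∀ k ∈ sellers ∪ buyers, 0 < bsIntensity k
  ueIntensity_pos : ∀ k ∈ sellers ∪ buyers, 0 < ueIntensity k
  threshold_pos : ∀ s ∈ sellers, 0 < threshold s
  sellerPower_pos : 0 < sellerPower
  two_lt_α : 2 < α

/-- The random objects of the network. The typical seller UE is at the origin. -/
structure Randomness (MNO Band Ω : Type*) where
  /-- `bs k n` is the location of BS number `n` of MNO `k` -/
  bs : MNO → ℕ → Ω → Plane
  /-- `ue k i` is the location of UE number `i` of MNO `k` -/
  ue : MNO → ℕ → Ω → Plane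
  /-- `gain l k n`: channel gain on `l` between BS `n` of MNO `k` and the typical UE of the seller
  that owns `l` -/
  gain : Band → MNO → ℕ → Ω → ℝ
  /-- `ueGain l i`: channel gain on `l` between UE `i` of the seller that owns `l` and a given
  buyer BS -/
  ueGain : Band → ℕ → Ω → ℝ
  /-- `power l k n`: transmit power on `l` of BS `n` of the buyer MNO `k` -/
  power : Band → MNO → ℕ → Ω → ℝ

variable {MNO Band Ω : Type*} [DecidableEq MNO]

/-- The largest interference channel gain, on sub-band `l` of seller `s`, from a buyer BS located
at `x` to the UEs of `s`. -/
def maxGain (N : Network MNO Band) (F : Randomness MNO Band Ω) (s : MNO) (l : Band) (x : Plane)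
    (ω : Ω) : ℝ :=
  ⨆ i : ℕ, F.ueGain l i ω * ‖x - F.ue s i ω‖ ^ (-N.α)

/-- The maximum allowable transmit power, on sub-band `l` of seller `s`, of a buyer BS located
at `x`. -/
def buyerPower (N : Network MNO Band) (F : Randomness MNO Band Ω) (s : MNO) (l : Band) (x : Plane)
    (ω : Ω) : ℝ :=
  N.threshold s / maxGain N F s l x ω

/-- Labels of the independent sources of randomness that enter the SINR of the typical UE of
seller `s` on `l`: the BS process of each MNO of the sharing group, the channel gain of each of
their BSs, and the transmit power of each buyer BS. -/
inductive Source (N : Network MNO Band) (s : MNO) (l : Band) : Type _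
  | bs (k : {k // k ∈ N.group l})
  | gain (k : {k // k ∈ N.group l}) (n : ℕ)
  | power (k : {k // k ∈ (N.group l).erase s}) (n : ℕ)

/-- The σ-algebra generated by a source of randomness. -/
@[reducible] def Source.sigma {N : Network MNO Band} {s : MNO} {l : Band} (F : Randomness MNO Band Ω) :
    Source N s l → MeasurableSpace Ω
  | .bs k => MeasurableSpace.comap (fun ω n => F.bs k n ω) inferInstance
  | .gain k n => MeasurableSpace.comap (F.gain l k n) inferInstance
  | .power k n => MeasurableSpace.comap (F.power l k n) inferInstance

/-- Labels of the sources of randomness in the power of a buyer BS at a given location: the UE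
process of the seller and the channel gains to its UEs. -/
inductive UESource : Type
  | ue
  | gain (i : ℕ)

/-- The σ-algebra generated by such a source of randomness. -/
@[reducible] def UESource.sigma (F : Randomness MNO Band Ω) (s : MNO) (l : Band) : UESource → MeasurableSpace Ω
  | .ue => MeasurableSpace.comap (fun ω i => F.ue s i ω) inferInstance
  | .gain i => MeasurableSpace.comap (F.ueGain l i) inferInstance

/-- The probabilistic model on sub-band `l` of seller `s`. All BS processes, and the UE process of
`s`, are homogeneous Poisson processes, and all channel gains are exponential with unit mean. The
transmit powers of the buyer BSs are independent marks of these BSs, independent of the locations and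
of the gains, each with the law of the maximum allowable power of a buyer
BS (whose law is computed at a location `x`). -/
structure IsModel [MeasurableSpace Ω] (P : Measure Ω) (N : Network MNO Band)
    (F : Randomness MNO Band Ω) (s : MNO) (l : Band) (x : Plane) : Prop where
  bs_poisson : ∀ k ∈ N.group l, IsPoissonProcess P (F.bs k) (N.bsIntensity k)
  ue_poisson : IsPoissonProcess P (F.ue s) (N.ueIntensity s)
  gain_measurable : ∀ k ∈ N.group l, ∀ n, Measurable (F.gain l k n)
  gain_law : ∀ k ∈ N.group l, ∀ n, P.map (F.gain l k n) = expMeasure 1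
  ueGain_measurable : ∀ i, Measurable (F.ueGain l i)
  ueGain_law : ∀ i, P.map (F.ueGain l i) = expMeasure 1
  ue_indep : iIndep (UESource.sigma F s l) P
  power_measurable : ∀ k ∈ (N.group l).erase s, ∀ n, Measurable (F.power l k n)
  power_law : ∀ k ∈ (N.group l).erase s, ∀ n,
    IdentDistrib (F.power l k n) (buyerPower N F s l x) P P
  indep : iIndep (Source.sigma (N := N) (s := s) (l := l) F) P

/-- The average power (fading has unit mean) received at the origin from BS `n` of seller `s`. -/
def meanRxPower (N : Network MNO Band) (F : Randomness MNO Band Ω) (s : MNO) (n : ℕ) (ω : Ω) : ℝ :=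
  N.sellerPower * ‖F.bs s n ω‖ ^ (-N.α)

/-- The BS of seller `s` with which the typical UE at the origin is associated: the one with
maximum average received power (almost surely there is exactly one). -/
def servingBS (N : Network MNO Band) (F : Randomness MNO Band Ω) (s : MNO) (ω : Ω) : ℕ :=
  sInf {n | ∀ m, meanRxPower N F s m ω ≤ meanRxPower N F s n ω}

/-- The distance of the typical UE to its serving BS. -/
def servingDist (N : Network MNO Band) (F : Randomness MNO Band Ω) (s : MNO) (ω : Ω) : ℝ :=
  ‖F.bs s (servingBS N F s ω) ω‖

/-- The interference at the typical UE of seller `s` on `l`: from all other BSs of `s`, and from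
all BSs of the buyers that share `l`. -/
def interference (N : Network MNO Band) (F : Randomness MNO Band Ω) (s : MNO) (l : Band)
    (ω : Ω) : ℝ≥0∞ :=
  (∑' n : {n : ℕ // n ≠ servingBS N F s ω},
      ENNReal.ofReal (N.sellerPower * F.gain l s n ω * ‖F.bs s n ω‖ ^ (-N.α))) +
    ∑ b ∈ (N.group l).erase s, ∑' n : ℕ,
      ENNReal.ofReal (F.power l b n ω * F.gain l b n ω * ‖F.bs b n ω‖ ^ (-N.α))

/-- The downlink SINR at the typical UE of seller `s` on `l`. -/
def sinr (N : Network MNO Band) (F : Randomness MNO Band Ω) (s : MNO) (l : Band) (ω : Ω) : ℝ≥0∞ :=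
  ENNReal.ofReal (N.sellerPower * F.gain l s (servingBS N F s ω) ω *
      servingDist N F s ω ^ (-N.α)) /
    (interference N F s l ω + ENNReal.ofReal (N.σ ^ 2))

/-- The σ-algebra generated by the transmit powers on `l` of all the buyer BSs. -/
@[reducible] def powerSigma (N : Network MNO Band) (F : Randomness MNO Band Ω) (s : MNO) (l : Band) :
    MeasurableSpace Ω :=
  MeasurableSpace.comap
    (fun ω (k : {k // k ∈ (N.group l).erase s}) (n : ℕ) => F.power l k n ω) inferInstance

/-- SINR coverage probability of the typical UE of seller `s` on `l`: the expectation, over the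
transmit powers of the buyer BSs, of the probability given these powers that the SINR is
above `β`. -/
def coverage [MeasurableSpace Ω] (P : Measure Ω) (N : Network MNO Band) (F : Randomness MNO Band Ω)
    (s : MNO) (l : Band) (β : ℝ) : ℝ :=
  ∫ ω, (P⟦{ω' | ENNReal.ofReal β < sinr N F s l ω'} | powerSigma N F s l⟧) ω ∂P

/-- `ρ(α, β)` -/
def rho (α β : ℝ) : ℝ := ∫ ν in Ioi (β ^ (-2 / α)), 1 / (1 + ν ^ (α / 2))

/-- `ρ(α, ∞)` -/
def rhoInfty (α : ℝ) : ℝ := ∫ ν in Ioi (0 : ℝ), 1 / (1 + ν ^ (α / 2))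

/-- The total intensity of the BSs of the buyers sharing `l`. -/
def buyerIntensity (N : Network MNO Band) (s : MNO) (l : Band) : ℝ :=
  ∑ b ∈ (N.group l).erase s, N.bsIntensity b

/-- The moment of order `2 / α` of the transmit power of a buyer BS. -/
def powerMoment [MeasurableSpace Ω] (P : Measure Ω) (N : Network MNO Band)
    (F : Randomness MNO Band Ω) (s : MNO) (l : Band) (x : Plane) : ℝ :=
  ∫ ω, buyerPower N F s l x ω ^ (2 / N.α) ∂P

/-- The closed form of the Laplace transform of the interference, at `κ`: the factor of the BSs of
the seller times the factor of the BSs of the buyers. -/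
def laplaceFormula [MeasurableSpace Ω] (P : Measure Ω) (N : Network MNO Band)
    (F : Randomness MNO Band Ω) (s : MNO) (l : Band) (x : Plane) (β κ : ℝ) : ℝ :=
  Real.exp (-(Real.pi * N.bsIntensity s * N.sellerPower ^ (2 / N.α) * κ ^ (2 / N.α) *
      rho N.α β)) *
    Real.exp (-(Real.pi * buyerIntensity N s l * powerMoment P N F s l x * κ ^ (2 / N.α) *
      rhoInfty N.α))

/-- The integrand of the coverage probability. -/
def coverageIntegrand [MeasurableSpace Ω] (P : Measure Ω) (N : Network MNO Band)
    (F : Randomness MNO Band Ω) (s : MNO) (l : Band) (x : Plane) (β z : ℝ) : ℝ :=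
  Real.pi * N.bsIntensity s * N.sellerPower ^ (2 / N.α) *
    Real.exp (-(β * N.σ ^ 2 * z ^ (N.α / 2))) *
    Real.exp (-(Real.pi * N.bsIntensity s * N.sellerPower ^ (2 / N.α) * z)) *
    laplaceFormula P N F s l x β (β * z ^ (N.α / 2))

end

end SpectrumSharing

/-!
The Laplace functional of an independently marked Poisson process `X` with mark law `ν` is
`E[exp (-∑ f (Xₙ, Mₙ))] = exp (-lam * ∫∫ (1 - exp (-f (y, m))) dν(m) dy)`. A function `f` equal to
`∞` on a set turns it into a void probability, so that it also gives the tail of the power of a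
buyer BS, hence its moment of order `2 / α`.

The serving distance is at least `r` when the ball of radius `r` contains no BS of the seller. For
`r ≤ t`, this event is independent of the interference from beyond `t`, and subtracting two such
events gives the mean of `exp (-κ * I)` with `I` taken from beyond `t` on the event
`r ≤ x₀ < t`. Cutting the range of `x₀` by a grid whose mesh tends to `0` and letting `t` be the
right end of the cell of `x₀` yields the Laplace transform of the interference given `x₀`.

The gain of the serving BS is exponential and independent of everything else in the SINR, so the
coverage probability is the mean of `exp (-κ * (I + σ²))` at `κ = β x₀ ^ α / Pˢ`. Conditioning on
`x₀`, whose square is exponential with rate `π * lam`, gives the integral.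
-/

open Filter Topology

namespace SpectrumSharing

noncomputable section

/-! ### The exponential of a negative extended real -/

section ExpNeg

/-- The function `a ↦ exp (-a)` on `[0, ∞]`, with `exp (-∞) = 0`. Laplace transforms are taken with
it because the interference may take the value `∞`. -/
def expNeg (a : ℝ≥0∞) : ℝ≥0∞ := EReal.exp (-(a : EReal))

@[simp] lemma expNeg_zero : expNeg 0 = 1 := by simp [expNeg]

@[simp] lemma expNeg_top : expNeg ∞ = 0 := by simp [expNeg]

lemma expNeg_add (a b : ℝ≥0∞) : expNeg (a + b) = expNeg a * expNeg b := by
  rw [expNeg, expNeg, expNeg, ← EReal.exp_add, EReal.coe_ennreal_add, EReal.neg_add, sub_eq_add_neg]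
  · left; simp
  · right; simp

lemma expNeg_sum {ι : Type*} (s : Finset ι) (f : ι → ℝ≥0∞) :
    expNeg (∑ i ∈ s, f i) = ∏ i ∈ s, expNeg (f i) := by
  classical
  induction s using Finset.induction_on with
  | empty => simp
  | insert a s ha ih => rw [Finset.sum_insert ha, Finset.prod_insert ha, expNeg_add, ih]

lemma expNeg_mul_natCast (a : ℝ≥0∞) (n : ℕ) : expNeg (a * n) = expNeg a ^ n := by
  simpa [mul_comm] using expNeg_sum (Finset.range n) fun _ => a

lemma expNeg_ofReal {x : ℝ} (hx : 0 ≤ x) :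
    expNeg (ENNReal.ofReal x) = ENNReal.ofReal (Real.exp (-x)) := by
  rw [expNeg, EReal.coe_ennreal_ofReal, max_eq_left hx, ← EReal.coe_neg, EReal.exp_coe]

lemma expNeg_eq_ofReal_exp {a : ℝ≥0∞} (ha : a ≠ ∞) :
    expNeg a = ENNReal.ofReal (Real.exp (-a.toReal)) := by
  rw [← expNeg_ofReal ENNReal.toReal_nonneg, ENNReal.ofReal_toReal ha]

lemma continuous_expNeg : Continuous expNeg :=
  ENNReal.continuous_exp.comp (continuous_neg.comp continuous_coe_ennreal_ereal)

@[fun_prop] lemma measurable_expNeg : Measurable expNeg := continuous_expNeg.measurable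

lemma expNeg_strictAnti : StrictAnti expNeg := fun _ _ h =>
  EReal.exp_strictMono (EReal.neg_lt_neg_iff.2 (EReal.coe_ennreal_lt_coe_ennreal_iff.2 h))

lemma expNeg_antitone : Antitone expNeg := expNeg_strictAnti.antitone

lemma expNeg_le_one (a : ℝ≥0∞) : expNeg a ≤ 1 := by
  simpa using expNeg_antitone (zero_le (a := a))

lemma expNeg_eq_zero {a : ℝ≥0∞} : expNeg a = 0 ↔ a = ∞ := by
  rw [← expNeg_top]; exact expNeg_strictAnti.injective.eq_iff

/-- The function `w ↦ -log w`, which inverts `expNeg` on `[0, 1]`. It turns a factor in `[0, 1]`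
into a term of the exponent. -/
def negLog (w : ℝ≥0∞) : ℝ≥0∞ := (-(ENNReal.log w)).toENNReal

@[fun_prop] lemma measurable_negLog : Measurable negLog :=
  measurable_ereal_toENNReal.comp (continuous_neg.measurable.comp ENNReal.measurable_log)

lemma expNeg_negLog {w : ℝ≥0∞} (hw : w ≤ 1) : expNeg (negLog w) = w := by
  have h : ENNReal.log w ≤ 0 := by simpa using hw
  rw [expNeg, negLog, EReal.coe_toENNReal (EReal.neg_nonneg.2 h), neg_neg, ENNReal.exp_log]

lemma tendsto_lintegral_expNeg {Ω : Type*} [MeasurableSpace Ω] {P : Measure Ω} [IsFiniteMeasure P]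
    {f : ℕ → Ω → ℝ≥0∞} {g : Ω → ℝ≥0∞} (hf : ∀ n, Measurable (f n))
    (h : ∀ᵐ ω ∂P, Tendsto (fun n => f n ω) atTop (𝓝 (g ω))) :
    Tendsto (fun n => ∫⁻ ω, expNeg (f n ω) ∂P) atTop (𝓝 (∫⁻ ω, expNeg (g ω) ∂P)) := by
  refine tendsto_lintegral_of_dominated_convergence (fun _ => 1)
    (fun n => measurable_expNeg.comp (hf n)) (fun n => ae_of_all _ fun ω => expNeg_le_one _)
    (by simp) ?_
  filter_upwards [h] with ω hω
  exact (continuous_expNeg.tendsto _).comp hω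

end ExpNeg

/-! ### The Laplace functional of a Poisson process -/

lemma lintegral_pow_poissonMeasure (r : ℝ≥0) {w : ℝ≥0∞} (hw : w ≤ 1) :
    ∫⁻ n, w ^ n ∂poissonMeasure r = expNeg (r * (1 - w)) := by
  lift w to ℝ≥0 using ne_top_of_le_ne_top (by simp) hw
  have hw' : (w : ℝ) ≤ 1 := by exact_mod_cast hw
  have tilt : ∀ n, (w : ℝ≥0∞) ^ n * poissonMeasure r {n} =
      ENNReal.ofReal (Real.exp (-(r * (1 - w)))) * poissonMeasure (r * w) {n} := fun n => by
    rw [poissonMeasure_singleton, poissonMeasure_singleton, ← ENNReal.ofReal_coe_nnreal,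
      ← ENNReal.ofReal_pow w.coe_nonneg, ← ENNReal.ofReal_mul (by positivity),
      ← ENNReal.ofReal_mul (by positivity), NNReal.coe_mul,
      show -(r : ℝ) = -(r * (1 - w)) + -(r * w) by ring, Real.exp_add]
    ring_nf
  have total : ∑' n, poissonMeasure (r * w) {n} = 1 := by
    simpa using (lintegral_countable' (μ := poissonMeasure (r * w)) fun _ => 1).symm
  have hexp : (r : ℝ≥0∞) * (1 - w) = ENNReal.ofReal (r * (1 - w)) := by
    rw [ENNReal.ofReal_mul r.coe_nonneg, ENNReal.ofReal_sub _ w.coe_nonneg]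
    simp
  rw [lintegral_countable', tsum_congr tilt, ENNReal.tsum_mul_left, total, mul_one, hexp,
    expNeg_ofReal (mul_nonneg r.coe_nonneg (sub_nonneg.2 hw'))]

lemma exists_simpleFunc_monotone_tendsto {S : Type*} [MeasurableSpace S] (μ : Measure S)
    [SigmaFinite μ] {u : S → ℝ≥0∞} (hu : Measurable u) :
    ∃ f : ℕ → SimpleFunc S ℝ≥0∞, (∀ k, μ {y | f k y ≠ 0} < ∞) ∧
      (∀ y, Monotone fun k => f k y) ∧ ∀ y, Tendsto (fun k => f k y) atTop (𝓝 (u y)) := by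
  let B := spanningSets μ
  have hf : ∀ k y, (SimpleFunc.eapprox u k).restrict (B k) y =
      (B k).indicator (SimpleFunc.eapprox u k) y := fun k y =>
    SimpleFunc.restrict_apply _ (measurableSet_spanningSets μ k) y
  refine ⟨fun k => (SimpleFunc.eapprox u k).restrict (B k), fun k => ?_, fun y i j hij => ?_,
    fun y => ?_⟩
  · refine (measure_mono fun y hy => ?_).trans_lt (measure_spanningSets_lt_top μ k)
    exact mem_of_indicator_ne_zero (by simpa only [mem_ofPred_eq, hf] using hy)
  · simp only [hf]
    exact (indicator_le_indicator (SimpleFunc.monotone_eapprox u hij y)).trans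
      (indicator_le_indicator_of_subset (monotone_spanningSets μ hij) (fun _ => zero_le) y)
  · have happrox : Tendsto (fun k => SimpleFunc.eapprox u k y) atTop (𝓝 (u y)) := by
      rw [← SimpleFunc.iSup_eapprox_apply hu y]
      exact tendsto_atTop_iSup fun i j hij => SimpleFunc.monotone_eapprox u hij y
    refine happrox.congr' ?_
    filter_upwards [eventually_ge_atTop (spanningSetsIndex μ y)] with k hk
    rw [hf, indicator_of_mem]
    exact monotone_spanningSets μ hk (mem_spanningSetsIndex μ y)

section PoissonProcess

lemma coe_count {Ω : Type*} (X : ℕ → Ω → Plane) {A : Set Plane} (hA : MeasurableSet A) (ω : Ω) :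
    (count X A ω : ℝ≥0∞) = Measure.sum (fun n => Measure.dirac (X n ω)) A := by
  rw [count, ← ENNReal.tsum_set_one, tsum_subtype {n | X n ω ∈ A} (fun _ => (1 : ℝ≥0∞)),
    Measure.sum_apply _ hA]
  exact tsum_congr fun n => (Measure.dirac_apply' _ hA).symm

lemma tsum_simpleFunc_eq_sum_count {Ω : Type*} (X : ℕ → Ω → Plane) (f : SimpleFunc Plane ℝ≥0∞)
    (ω : Ω) :
    ∑' n, f (X n ω) =
      ∑ c : (f.range.erase 0 : Finset ℝ≥0∞), (c : ℝ≥0∞) * count X (f ⁻¹' {c.1}) ω := by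
  calc ∑' n, f (X n ω)
      = ∫⁻ y, f y ∂Measure.sum fun n => Measure.dirac (X n ω) := by
        simp [lintegral_sum_measure, lintegral_dirac' _ f.measurable]
    _ = ∑ c ∈ f.range, c * Measure.sum (fun n => Measure.dirac (X n ω)) (f ⁻¹' {c}) :=
        f.lintegral_eq_lintegral _
    _ = ∑ c ∈ f.range.erase 0, c * count X (f ⁻¹' {c}) ω := by
        rw [← Finset.sum_erase (a := 0) _ (zero_mul _)]
        exact Finset.sum_congr rfl fun c _ => by rw [coe_count X (f.measurableSet_fiber c)]
    _ = _ := (Finset.sum_coe_sort _ fun c => c * (count X (f ⁻¹' {c}) ω : ℝ≥0∞)).symm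

variable {Ω : Type*} [MeasurableSpace Ω] {P : Measure Ω} {X : ℕ → Ω → Plane} {lam : ℝ}

lemma measurable_count (hX : ∀ n, Measurable (X n)) {A : Set Plane} (hA : MeasurableSet A) :
    Measurable (count X A) := by
  have hcoe : Measurable fun ω => (count X A ω : ℝ≥0∞) := by
    simp only [coe_count X hA, Measure.sum_apply _ hA]
    exact Measurable.tsum fun n => (Measure.measurable_coe hA).comp
      (Measure.measurable_dirac.comp (hX n))
  refine measurable_to_countable' fun j => ?_
  have : count X A ⁻¹' {j} = (fun ω => (count X A ω : ℝ≥0∞)) ⁻¹' {(j : ℝ≥0∞)} := by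
    ext ω; simp
  rw [this]
  exact hcoe (measurableSet_singleton _)

lemma IsPoissonProcess.iIndepFun_count (hX : IsPoissonProcess P X lam) {ι : Type*} [Finite ι]
    {A : ι → Set Plane} (hA : ∀ i, MeasurableSet (A i)) (hA' : ∀ i, volume (A i) < ∞)
    (hd : Pairwise fun i j => Disjoint (A i) (A j)) :
    iIndepFun (fun i => count X (A i)) P := by
  let e := Finite.equivFin ι
  have h := hX.count_indep _ (fun i => A (e.symm i)) (fun i => hA _) (fun i => hA' _)
    fun i j hij => hd (e.symm.injective.ne hij)
  simpa using h.precomp e.injective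

variable [IsProbabilityMeasure P]

lemma IsPoissonProcess.map_count (hX : IsPoissonProcess P X lam)
    {A : Set Plane} (hA : MeasurableSet A) (hA' : volume A < ∞) :
    P.map (count X A) =
      (poissonMeasure (lam * (volume A).toReal).toNNReal).map (Nat.cast : ℕ → ℕ∞) := by
  set ν := poissonMeasure (lam * (volume A).toReal).toNNReal
  have hm := measurable_count hX.measurable hA
  have hcast : MeasurableEmbedding (Nat.cast : ℕ → ℕ∞) :=
    ⟨Nat.cast_injective, measurable_of_countable _, fun _ _ => MeasurableSet.of_discrete⟩
  have : IsProbabilityMeasure (P.map (count X A)) :=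
    Measure.isProbabilityMeasure_map hm.aemeasurable
  have : IsProbabilityMeasure (ν.map (Nat.cast : ℕ → ℕ∞)) :=
    Measure.isProbabilityMeasure_map hcast.measurable.aemeasurable
  have hν : ν = (P.map (count X A)).comap (Nat.cast : ℕ → ℕ∞) := by
    refine Measure.ext_of_singleton fun j => ?_
    rw [hcast.comap_apply, image_singleton, Measure.map_apply hm (measurableSet_singleton _)]
    exact (hX.count_law A hA hA' j).symm
  refine (Measure.eq_of_le_of_isProbabilityMeasure ?_).symm
  rw [hν, hcast.map_comap]
  exact Measure.restrict_le_self

lemma IsPoissonProcess.lintegral_expNeg_count (hX : IsPoissonProcess P X lam) {A : Set Plane}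
    (hA : MeasurableSet A) (hA' : volume A < ∞) (c : ℝ≥0∞) :
    ∫⁻ ω, expNeg (c * count X A ω) ∂P =
      expNeg (ENNReal.ofReal lam * ((1 - expNeg c) * volume A)) := by
  rw [← lintegral_map (f := fun j : ℕ∞ => expNeg (c * (j : ℝ≥0∞))) (measurable_of_countable _)
      (measurable_count hX.measurable hA), hX.map_count hA hA',
    lintegral_map (measurable_of_countable _) (measurable_of_countable _)]
  simp only [ENat.toENNReal_coe, expNeg_mul_natCast]
  rw [lintegral_pow_poissonMeasure _ (expNeg_le_one c), ENNReal.ofNNReal_toNNReal, mul_comm lam,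
    ENNReal.ofReal_mul ENNReal.toReal_nonneg, ENNReal.ofReal_toReal hA'.ne]
  congr 1
  ring

lemma IsPoissonProcess.lintegral_expNeg_sum_count (hX : IsPoissonProcess P X lam) {ι : Type*}
    [Fintype ι] {A : ι → Set Plane} (hA : ∀ i, MeasurableSet (A i)) (hA' : ∀ i, volume (A i) < ∞)
    (hd : Pairwise fun i j => Disjoint (A i) (A j)) (c : ι → ℝ≥0∞) :
    ∫⁻ ω, expNeg (∑ i, c i * count X (A i) ω) ∂P =
      expNeg (ENNReal.ofReal lam * ∑ i, (1 - expNeg (c i)) * volume (A i)) := by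
  have hind := (hX.iIndepFun_count hA hA' hd).comp
    (fun i (j : ℕ∞) => expNeg (c i * (j : ℝ≥0∞))) fun i => measurable_of_countable _
  simp_rw [Finset.mul_sum, expNeg_sum]
  refine (lintegral_prod_eq_prod_lintegral_of_indepFun Finset.univ _ hind fun i =>
    (measurable_of_countable _).comp (measurable_count hX.measurable (hA i))).trans ?_
  exact Finset.prod_congr rfl fun i _ => hX.lintegral_expNeg_count (hA i) (hA' i) (c i)

lemma IsPoissonProcess.lintegral_expNeg_simpleFunc (hX : IsPoissonProcess P X lam)
    (f : SimpleFunc Plane ℝ≥0∞) (hf : volume {y | f y ≠ 0} < ∞) :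
    ∫⁻ ω, expNeg (∑' n, f (X n ω)) ∂P =
      expNeg (ENNReal.ofReal lam * ∫⁻ y, (1 - expNeg (f y))) := by
  have hfiber : ∀ c : (f.range.erase 0 : Finset ℝ≥0∞), volume (f ⁻¹' {c.1}) < ∞ := fun c => by
    refine (measure_mono fun y hy => ?_).trans_lt hf
    rw [mem_ofPred_eq, show f y = c from hy]
    exact (Finset.mem_erase.1 c.2).1
  have hint : ∫⁻ y, (1 - expNeg (f y)) =
      ∑ c : (f.range.erase 0 : Finset ℝ≥0∞), (1 - expNeg c) * volume (f ⁻¹' {c.1}) := by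
    rw [Finset.sum_coe_sort _ fun c => (1 - expNeg c) * volume (f ⁻¹' {c}),
      Finset.sum_erase _ (by simp), ← f.map_lintegral fun c => 1 - expNeg c]
    exact (f.map fun c => 1 - expNeg c).lintegral_eq_lintegral volume
  simp_rw [tsum_simpleFunc_eq_sum_count, hint]
  refine hX.lintegral_expNeg_sum_count (fun c => f.measurableSet_fiber _) hfiber
    (fun c d hcd => ?_) _
  exact (disjoint_singleton.2 fun h => hcd (Subtype.ext h)).preimage f

theorem IsPoissonProcess.lintegral_expNeg_tsum (hX : IsPoissonProcess P X lam)
    {u : Plane → ℝ≥0∞} (hu : Measurable u) :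
    ∫⁻ ω, expNeg (∑' n, u (X n ω)) ∂P =
      expNeg (ENNReal.ofReal lam * ∫⁻ y, (1 - expNeg (u y))) := by
  obtain ⟨f, hf, hmono, hlim⟩ := exists_simpleFunc_monotone_tendsto volume hu
  have hL : Tendsto (fun k => ∫⁻ ω, expNeg (∑' n, f k (X n ω)) ∂P) atTop
      (𝓝 (∫⁻ ω, expNeg (∑' n, u (X n ω)) ∂P)) := by
    refine tendsto_lintegral_expNeg (fun k => Measurable.tsum fun n =>
      (f k).measurable.comp (hX.measurable n)) (ae_of_all _ fun ω => ?_)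
    simp_rw [← lintegral_count]
    exact lintegral_tendsto_of_tendsto_of_monotone
      (fun k => (measurable_of_countable _).aemeasurable) (ae_of_all _ fun n => hmono _)
      (ae_of_all _ fun n => hlim _)
  have hR : Tendsto (fun k => ∫⁻ y, (1 - expNeg (f k y))) atTop (𝓝 (∫⁻ y, (1 - expNeg (u y)))) := by
    refine lintegral_tendsto_of_tendsto_of_monotone
      (fun k => (measurable_const.sub (measurable_expNeg.comp (f k).measurable)).aemeasurable)
      (ae_of_all _ fun y i j hij => tsub_le_tsub_left (expNeg_antitone (hmono y hij)) 1)
      (ae_of_all _ fun y => ?_)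
    exact ENNReal.Tendsto.sub tendsto_const_nhds ((continuous_expNeg.tendsto _).comp (hlim y))
      (Or.inl (by simp))
  simp_rw [fun k => hX.lintegral_expNeg_simpleFunc (f k) (hf k)] at hL
  exact tendsto_nhds_unique hL
    ((continuous_expNeg.tendsto _).comp (ENNReal.Tendsto.const_mul hR (Or.inr (by simp))))

end PoissonProcess

/-! ### Independent marks -/

section Marks

lemma lintegral_comp_prodMk_of_indepFun {Ω S E : Type*} [MeasurableSpace Ω] {P : Measure Ω}
    [IsProbabilityMeasure P] [MeasurableSpace S] [MeasurableSpace E] {A : Ω → S} {M : Ω → E}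
    (hA : Measurable A) (hM : Measurable M) (h : IndepFun A M P) {H : S × E → ℝ≥0∞}
    (hH : Measurable H) :
    ∫⁻ ω, H (A ω, M ω) ∂P = ∫⁻ ω, ∫⁻ m, H (A ω, m) ∂(P.map M) ∂P := by
  have : IsProbabilityMeasure (P.map M) := Measure.isProbabilityMeasure_map hM.aemeasurable
  rw [← lintegral_map hH (hA.prodMk hM),
    (indepFun_iff_map_prod_eq_prod_map_map hA.aemeasurable hM.aemeasurable).1 h,
    lintegral_prod _ hH.aemeasurable, lintegral_map hH.lintegral_prod_right' hA]

lemma lintegral_comp_of_indep {Ω E : Type*} {𝓐 mΩ : MeasurableSpace Ω} {P : Measure Ω}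
    [IsProbabilityMeasure P] [mE : MeasurableSpace E] {M : Ω → E} (h𝓐 : 𝓐 ≤ mΩ)
    (hM : Measurable M) (h : Indep (mE.comap M) 𝓐 P) {H : Ω × E → ℝ≥0∞}
    (hH : Measurable[𝓐.prod mE] H) :
    ∫⁻ ω, H (ω, M ω) ∂P = ∫⁻ ω, ∫⁻ m, H (ω, m) ∂(P.map M) ∂P := by
  have hI : @IndepFun Ω Ω E mΩ 𝓐 mE id M P := by
    refine (@IndepFun_iff_Indep Ω Ω E mΩ 𝓐 mE id M P).2 ?_
    rw [MeasurableSpace.comap_id]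
    exact h.symm
  exact @lintegral_comp_prodMk_of_indepFun Ω Ω E mΩ P _ 𝓐 mE id M
    (measurable_id'' h𝓐) hM hI H hH

variable {Ω S E : Type*} [mS : MeasurableSpace S] [mE : MeasurableSpace E]
  {X : ℕ → Ω → S} {M : ℕ → Ω → E}

/-- The σ-algebra generated by the points of an enumerated configuration. -/
@[reducible] def pointSigma (X : ℕ → Ω → S) : MeasurableSpace Ω :=
  MeasurableSpace.comap (fun ω k => X k ω) inferInstance

/-- The σ-algebra generated by all the points and the marks of the first `n` of them. -/
@[reducible] def markedSigma (X : ℕ → Ω → S) (M : ℕ → Ω → E) (n : ℕ) : MeasurableSpace Ω :=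
  pointSigma X ⊔ ⨆ j ∈ {j | j < n}, mE.comap (M j)

lemma measurable_pointSigma (X : ℕ → Ω → S) (n : ℕ) : Measurable[pointSigma X] (X n) :=
  (measurable_pi_apply n).comp (comap_measurable fun ω k => X k ω)

lemma pointSigma_le_markedSigma (X : ℕ → Ω → S) (M : ℕ → Ω → E) (n : ℕ) :
    pointSigma X ≤ markedSigma X M n := le_sup_left

lemma measurable_markedSigma (X : ℕ → Ω → S) (M : ℕ → Ω → E) {j n : ℕ} (hj : j < n) :
    Measurable[markedSigma X M n] (M j) :=
  (comap_measurable (M j)).mono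
    ((le_iSup₂ (f := fun j (_ : j ∈ {j | j < n}) => mE.comap (M j)) j hj).trans le_sup_right) le_rfl

lemma markedSigma_le {m : MeasurableSpace Ω} (hX : ∀ n, Measurable[m] (X n))
    (hM : ∀ n, Measurable[m] (M n)) (n : ℕ) : markedSigma X M n ≤ m :=
  sup_le (measurable_pi_lambda _ hX).comap_le (iSup₂_le fun j _ => (hM j).comap_le)

/-- `M 0, M 1, …` are independent marks with law `ν` of the points `X 0, X 1, …`: each mark is
independent of all the points and of the marks of the earlier ones. -/
structure IsIndepMarking [MeasurableSpace Ω] (P : Measure Ω) (X : ℕ → Ω → S) (M : ℕ → Ω → E)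
    (ν : Measure E) : Prop where
  measurable : ∀ n, Measurable (M n)
  map_eq : ∀ n, P.map (M n) = ν
  indep : ∀ n, Indep (mE.comap (M n)) (markedSigma X M n) P

variable [MeasurableSpace Ω] {P : Measure Ω} [IsProbabilityMeasure P] {ν : Measure E}

lemma IsIndepMarking.isProbabilityMeasure (hM : IsIndepMarking P X M ν) :
    IsProbabilityMeasure ν := by
  rw [← hM.map_eq 0]
  exact Measure.isProbabilityMeasure_map (hM.measurable 0).aemeasurable

lemma IsIndepMarking.lintegral_mul_prod (hM : IsIndepMarking P X M ν)
    (hX : ∀ n, Measurable (X n)) {e : S × E → ℝ≥0∞} (he : Measurable e) (n : ℕ) {G : Ω → ℝ≥0∞}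
    (hG : Measurable[pointSigma X] G) :
    ∫⁻ ω, G ω * ∏ j ∈ Finset.range n, e (X j ω, M j ω) ∂P =
      ∫⁻ ω, G ω * ∏ j ∈ Finset.range n, (∫⁻ m, e (X j ω, m) ∂ν) ∂P := by
  have := hM.isProbabilityMeasure
  induction n generalizing G with
  | zero => simp
  | succ n ih =>
    have hle := pointSigma_le_markedSigma X M n
    have hXn : ∀ j, Measurable[markedSigma X M n] (X j) := fun j =>
      (measurable_pointSigma X j).mono hle le_rfl
    have hpast : Measurable[markedSigma X M n]
        fun ω => G ω * ∏ j ∈ Finset.range n, e (X j ω, M j ω) :=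
      Measurable.mul (hG.mono hle le_rfl) (Finset.measurable_prod _ fun j hj =>
        he.comp ((hXn j).prodMk (measurable_markedSigma X M (Finset.mem_range.1 hj))))
    have hH : Measurable[(markedSigma X M n).prod mE] fun q : Ω × E =>
        (G q.1 * ∏ j ∈ Finset.range n, e (X j q.1, M j q.1)) * e (X n q.1, q.2) :=
      Measurable.mul (hpast.comp measurable_fst)
        (he.comp (((hXn n).comp measurable_fst).prodMk measurable_snd))
    have hmean : Measurable[pointSigma X] fun ω => G ω * ∫⁻ m, e (X n ω, m) ∂ν :=
      Measurable.mul hG (he.lintegral_prod_right'.comp (measurable_pointSigma X n))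
    calc ∫⁻ ω, G ω * ∏ j ∈ Finset.range (n + 1), e (X j ω, M j ω) ∂P
        = ∫⁻ ω, (G ω * ∏ j ∈ Finset.range n, e (X j ω, M j ω)) * e (X n ω, M n ω) ∂P := by
          simp_rw [Finset.prod_range_succ, ← mul_assoc]
      _ = ∫⁻ ω, ∫⁻ m, (G ω * ∏ j ∈ Finset.range n, e (X j ω, M j ω)) * e (X n ω, m) ∂ν ∂P := by
          rw [← hM.map_eq n]
          exact lintegral_comp_of_indep (markedSigma_le hX hM.measurable n) (hM.measurable n)
            (hM.indep n) hH
      _ = ∫⁻ ω, (G ω * ∫⁻ m, e (X n ω, m) ∂ν) * ∏ j ∈ Finset.range n, e (X j ω, M j ω) ∂P := by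
          refine lintegral_congr fun ω => ?_
          rw [lintegral_const_mul _ (f := fun m => e (X n ω, m)) (he.comp measurable_prodMk_left)]
          ring
      _ = ∫⁻ ω, (G ω * ∫⁻ m, e (X n ω, m) ∂ν) *
            ∏ j ∈ Finset.range n, (∫⁻ m, e (X j ω, m) ∂ν) ∂P := ih hmean
      _ = _ := lintegral_congr fun ω => by rw [Finset.prod_range_succ]; ring

lemma IsIndepMarking.lintegral_expNeg_tsum (hM : IsIndepMarking P X M ν)
    (hX : ∀ n, Measurable (X n)) {v : S × E → ℝ≥0∞} (hv : Measurable v) :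
    ∫⁻ ω, expNeg (∑' n, v (X n ω, M n ω)) ∂P =
      ∫⁻ ω, expNeg (∑' n, negLog (∫⁻ m, expNeg (v (X n ω, m)) ∂ν)) ∂P := by
  have := hM.isProbabilityMeasure
  have he : Measurable fun q => expNeg (v q) := measurable_expNeg.comp hv
  have hle : ∀ y, ∫⁻ m, expNeg (v (y, m)) ∂ν ≤ 1 := fun y =>
    (lintegral_mono fun m => expNeg_le_one _).trans (by simp)
  have hpartial : ∀ n, ∫⁻ ω, expNeg (∑ j ∈ Finset.range n, v (X j ω, M j ω)) ∂P =
      ∫⁻ ω, expNeg (∑ j ∈ Finset.range n, negLog (∫⁻ m, expNeg (v (X j ω, m)) ∂ν)) ∂P := fun n => by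
    simpa only [expNeg_sum, one_mul, expNeg_negLog (hle _)] using
      hM.lintegral_mul_prod hX he n (G := fun _ => 1) measurable_const
  have hL := tendsto_lintegral_expNeg (P := P)
    (f := fun n ω => ∑ j ∈ Finset.range n, v (X j ω, M j ω))
    (fun n => Finset.measurable_sum _ fun j _ => hv.comp ((hX j).prodMk (hM.measurable j)))
    (ae_of_all _ fun ω => ENNReal.summable.hasSum.tendsto_sum_nat)
  have hR := tendsto_lintegral_expNeg (P := P)
    (f := fun n ω => ∑ j ∈ Finset.range n, negLog (∫⁻ m, expNeg (v (X j ω, m)) ∂ν))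
    (fun n => Finset.measurable_sum _ fun j _ =>
      measurable_negLog.comp (he.lintegral_prod_right'.comp (hX j)))
    (ae_of_all _ fun ω => ENNReal.summable.hasSum.tendsto_sum_nat)
  simp_rw [hpartial] at hL
  exact tendsto_nhds_unique hL hR

theorem IsPoissonProcess.lintegral_expNeg_tsum_marked {X : ℕ → Ω → Plane} {lam : ℝ}
    (hX : IsPoissonProcess P X lam) (hM : IsIndepMarking P X M ν) {v : Plane × E → ℝ≥0∞}
    (hv : Measurable v) :
    ∫⁻ ω, expNeg (∑' n, v (X n ω, M n ω)) ∂P =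
      expNeg (ENNReal.ofReal lam * ∫⁻ y, ∫⁻ m, (1 - expNeg (v (y, m))) ∂ν) := by
  have := hM.isProbabilityMeasure
  have he : Measurable fun q => expNeg (v q) := measurable_expNeg.comp hv
  have hle : ∀ y, ∫⁻ m, expNeg (v (y, m)) ∂ν ≤ 1 := fun y =>
    (lintegral_mono fun m => expNeg_le_one _).trans (by simp)
  rw [hM.lintegral_expNeg_tsum hX.measurable hv,
    hX.lintegral_expNeg_tsum (u := fun y => negLog (∫⁻ m, expNeg (v (y, m)) ∂ν))
      (measurable_negLog.comp he.lintegral_prod_right')]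
  congr 2
  refine lintegral_congr fun y => ?_
  rw [expNeg_negLog (hle y), lintegral_sub (g := fun m => expNeg (v (y, m)))
    (he.comp measurable_prodMk_left) (ne_top_of_le_ne_top (by simp) (hle y))
    (ae_of_all _ fun m => expNeg_le_one _)]
  simp

end Marks

/-! ### Polar coordinates and path loss -/

section Polar

lemma measure_ext_of_Iic {μ ν : Measure ℝ} (hμ : ∀ b, μ (Iic b) ≠ ∞)
    (h : ∀ b, μ (Iic b) = ν (Iic b)) : μ = ν := by
  refine Measure.ext_of_generateFrom_of_iUnion (range Iic) (fun n : ℕ => Iic (n : ℝ)) ?_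
    isPiSystem_Iic (iUnion_eq_univ_iff.2 exists_nat_ge) (fun n => mem_range_self _)
    (fun n => hμ n) (forall_mem_range.2 h)
  rw [← borel_eq_generateFrom_Iic]
  exact BorelSpace.measurable_eq

lemma volume_norm_sq_le (b : ℝ) :
    volume {y : Plane | ‖y‖ ^ 2 ≤ b} = ENNReal.ofReal Real.pi * ENNReal.ofReal b := by
  rcases lt_or_ge b 0 with hb | hb
  · have hempty : {y : Plane | ‖y‖ ^ 2 ≤ b} = ∅ :=
      eq_empty_of_forall_notMem fun y hy => (hb.trans_le (sq_nonneg ‖y‖)).not_ge hy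
    simp [hempty, ENNReal.ofReal_of_nonpos hb.le]
  · have hball : {y : Plane | ‖y‖ ^ 2 ≤ b} = Metric.closedBall 0 (Real.sqrt b) := by
      ext y
      rw [mem_closedBall_zero_iff]
      exact (Real.le_sqrt (norm_nonneg y) hb).symm
    rw [hball, EuclideanSpace.volume_closedBall_fin_two,
      ← ENNReal.ofReal_pow (Real.sqrt_nonneg b), Real.sq_sqrt hb, mul_comm]

lemma map_norm_sq_volume : Measure.map (fun y : Plane => ‖y‖ ^ 2) volume =
    ENNReal.ofReal Real.pi • volume.restrict (Ioi (0 : ℝ)) := by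
  have hmap : ∀ b : ℝ, Measure.map (fun y : Plane => ‖y‖ ^ 2) volume (Iic b) =
      ENNReal.ofReal Real.pi * ENNReal.ofReal b := fun b => by
    rw [Measure.map_apply (by fun_prop) measurableSet_Iic]
    exact volume_norm_sq_le b
  refine measure_ext_of_Iic (fun b => ?_) fun b => ?_
  · rw [hmap]
    exact ENNReal.mul_ne_top (by simp) (by simp)
  · rw [hmap, Measure.smul_apply, Measure.restrict_apply measurableSet_Iic, inter_comm,
      Ioi_inter_Iic, Real.volume_Ioc, sub_zero, smul_eq_mul]

lemma lintegral_norm_sq {f : ℝ → ℝ≥0∞} (hf : Measurable f) :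
    ∫⁻ y : Plane, f (‖y‖ ^ 2) = ENNReal.ofReal Real.pi * ∫⁻ v in Ioi (0 : ℝ), f v := by
  rw [← lintegral_map hf (by fun_prop), map_norm_sq_volume, lintegral_smul_measure, smul_eq_mul]

lemma setLIntegral_norm_sq {f : ℝ → ℝ≥0∞} (hf : Measurable f) {t : ℝ} (ht : 0 ≤ t) :
    ∫⁻ y in {y : Plane | t ≤ ‖y‖}, f (‖y‖ ^ 2) =
      ENNReal.ofReal Real.pi * ∫⁻ v in Ioi (t ^ 2), f v := by
  have hmeas : MeasurableSet {y : Plane | t ≤ ‖y‖} :=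
    measurableSet_le measurable_const measurable_norm
  have hind : ∀ y : Plane, {y : Plane | t ≤ ‖y‖}.indicator (fun y => f (‖y‖ ^ 2)) y =
      (Ici (t ^ 2)).indicator f (‖y‖ ^ 2) := fun y => by
    simp only [indicator, mem_ofPred_eq, mem_Ici, sq_le_sq₀ ht (norm_nonneg y)]
  have hIci : (Ici (t ^ 2) ∩ Ioi 0 : Set ℝ) =ᵐ[volume] Ioi (t ^ 2) := by
    refine (Ioi_ae_eq_Ici.symm.inter (ae_eq_refl (Ioi (0 : ℝ)))).trans ?_
    rw [Ioi_inter_Ioi, sup_of_le_left (sq_nonneg t)]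
    exact ae_eq_refl _
  rw [← lintegral_indicator hmeas]
  simp_rw [hind]
  rw [lintegral_norm_sq (hf.indicator measurableSet_Ici), lintegral_indicator measurableSet_Ici,
    Measure.restrict_restrict measurableSet_Ici, setLIntegral_congr hIci]

lemma setLIntegral_Ioi_mul_left {c : ℝ} (hc : 0 < c) (b : ℝ) {f : ℝ → ℝ≥0∞} (hf : Measurable f) :
    ∫⁻ v in Ioi (c * b), f v = ENNReal.ofReal c * ∫⁻ u in Ioi b, f (c * u) := by
  rw [← lintegral_indicator measurableSet_Ioi, ← lintegral_indicator measurableSet_Ioi]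
  conv_lhs => rw [← Real.smul_map_volume_mul_left hc.ne', abs_of_pos hc]
  rw [lintegral_smul_measure, smul_eq_mul,
    lintegral_map (hf.indicator measurableSet_Ioi) (measurable_const_mul c)]
  simp only [indicator, mem_Ioi, mul_lt_mul_iff_right₀ hc]

end Polar

section Exponential

lemma lintegral_expMeasure {r : ℝ} {f : ℝ → ℝ≥0∞} (hf : Measurable f) :
    ∫⁻ h, f h ∂(expMeasure r) = ∫⁻ h, exponentialPDF r h * f h := by
  have hm : Measurable (gammaPDF 1 r) := (measurable_gammaPDFReal 1 r).ennreal_ofReal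
  rw [expMeasure, gammaMeasure, lintegral_withDensity_eq_lintegral_mul _ hm hf]
  rfl

lemma expMeasure_setOf_lt_ofReal {r : ℝ} (hr : 0 < r) (a : ℝ≥0∞) :
    expMeasure r {h | a < ENNReal.ofReal h} = expNeg (ENNReal.ofReal r * a) := by
  have := isProbabilityMeasure_expMeasure hr
  by_cases ha : a = ∞
  · simp [ha, hr]
  have hcompl : {h : ℝ | a < ENNReal.ofReal h} = (Iic a.toReal)ᶜ := by
    ext h
    simp [ENNReal.lt_ofReal_iff_toReal_lt ha]
  rw [hcompl, measure_compl measurableSet_Iic (measure_ne_top _ _), measure_univ, ← ofReal_cdf,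
    cdf_expMeasure_eq hr, if_pos ENNReal.toReal_nonneg,
    expNeg_eq_ofReal_exp (ENNReal.mul_ne_top (by simp) ha), ← ENNReal.ofReal_one,
    ← ENNReal.ofReal_sub _ (by simpa using by positivity), sub_sub_cancel, ENNReal.toReal_mul,
    ENNReal.toReal_ofReal hr.le]

lemma expMeasure_ae_pos {r : ℝ} (hr : 0 < r) : ∀ᵐ h ∂(expMeasure r), 0 < h := by
  have := isProbabilityMeasure_expMeasure hr
  have hpos : expMeasure r {h | 0 < h} = 1 := by
    simpa using expMeasure_setOf_lt_ofReal hr 0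
  exact (prob_compl_eq_zero_iff (measurableSet_lt measurable_const measurable_id)).2 hpos

lemma lintegral_expNeg_expMeasure {r a : ℝ} (hr : 0 < r) (ha : 0 ≤ a) :
    ∫⁻ h, expNeg (ENNReal.ofReal (a * h)) ∂(expMeasure r) = ENNReal.ofReal (r / (r + a)) := by
  have htilt : ∀ h : ℝ, exponentialPDF r h * expNeg (ENNReal.ofReal (a * h)) =
      ENNReal.ofReal (r / (r + a)) * exponentialPDF (r + a) h := by
    intro h
    rcases lt_or_ge h 0 with hh | hh
    · simp [exponentialPDF_of_neg hh]
    · rw [exponentialPDF_of_nonneg hh, exponentialPDF_of_nonneg hh, expNeg_ofReal (by positivity),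
        ← ENNReal.ofReal_mul (by positivity), ← ENNReal.ofReal_mul (by positivity), mul_assoc,
        ← Real.exp_add, ← mul_assoc, div_mul_cancel₀ _ (by positivity)]
      ring_nf
  simp_rw [lintegral_expMeasure (show Measurable fun h => expNeg (ENNReal.ofReal (a * h)) by
    fun_prop), htilt]
  rw [lintegral_const_mul' _ _ (by simp), lintegral_exponentialPDF_eq_one (by positivity), mul_one]

lemma lintegral_one_sub_expNeg_expMeasure {r a : ℝ} (hr : 0 < r) (ha : 0 ≤ a) :
    ∫⁻ h, (1 - expNeg (ENNReal.ofReal (a * h))) ∂(expMeasure r) = ENNReal.ofReal (a / (r + a)) := by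
  have := isProbabilityMeasure_expMeasure hr
  have hlaplace := lintegral_expNeg_expMeasure hr ha
  rw [lintegral_sub (by fun_prop) (by rw [hlaplace]; simp) (ae_of_all _ fun h => expNeg_le_one _),
    hlaplace, lintegral_one, measure_univ, ← ENNReal.ofReal_one,
    ← ENNReal.ofReal_sub _ (by positivity), one_sub_div (by positivity), add_sub_cancel_left]

end Exponential

section PathLoss

variable {α : ℝ}

lemma integrableOn_one_div_one_add_rpow (hα : 2 < α) {b : ℝ} (hb : 0 ≤ b) :
    IntegrableOn (fun v : ℝ => 1 / (1 + v ^ (α / 2))) (Ioi b) := by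
  have hmeas : Measurable fun v : ℝ => 1 / (1 + v ^ (α / 2)) := by fun_prop
  refine IntegrableOn.mono_set ?_ (Ioi_subset_Ioi hb)
  rw [← Ioc_union_Ioi_eq_Ioi zero_le_one]
  refine IntegrableOn.union ?_ ?_
  · refine Measure.integrableOn_of_bounded (M := 1) (by simp) hmeas.aestronglyMeasurable ?_
    refine (ae_restrict_iff' measurableSet_Ioc).2 (ae_of_all _ fun v hv => ?_)
    have : 0 ≤ v ^ (α / 2) := Real.rpow_nonneg hv.1.le _
    rw [Real.norm_of_nonneg (by positivity), div_le_one (by positivity)]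
    linarith
  · refine Integrable.mono' (integrableOn_Ioi_rpow_of_lt (a := -(α / 2)) (by linarith) one_pos)
      hmeas.aestronglyMeasurable ?_
    refine (ae_restrict_iff' measurableSet_Ioi).2 (ae_of_all _ fun v hv => ?_)
    have hv0 : (0 : ℝ) < v := one_pos.trans hv
    have : 0 < v ^ (α / 2) := Real.rpow_pos_of_pos hv0 _
    rw [Real.norm_of_nonneg (by positivity), Real.rpow_neg hv0.le, ← one_div]
    exact one_div_le_one_div_of_le this (by linarith)

lemma one_div_one_add_rpow_nonneg (α : ℝ) {b : ℝ} (hb : 0 ≤ b) :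
    ∀ v ∈ Ioi b, 0 ≤ 1 / (1 + v ^ (α / 2)) := fun v hv => by
  have : 0 ≤ v ^ (α / 2) := Real.rpow_nonneg (hb.trans (le_of_lt hv)) _
  positivity

lemma integral_one_div_one_add_rpow_nonneg (α : ℝ) {b : ℝ} (hb : 0 ≤ b) :
    0 ≤ ∫ v in Ioi b, 1 / (1 + v ^ (α / 2)) :=
  setIntegral_nonneg measurableSet_Ioi (one_div_one_add_rpow_nonneg α hb)

lemma rho_nonneg (α : ℝ) {β : ℝ} (hβ : 0 ≤ β) : 0 ≤ rho α β :=
  integral_one_div_one_add_rpow_nonneg α (Real.rpow_nonneg hβ _)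

lemma rhoInfty_nonneg (α : ℝ) : 0 ≤ rhoInfty α :=
  integral_one_div_one_add_rpow_nonneg α le_rfl

lemma lintegral_one_div_one_add_rpow (hα : 2 < α) {b : ℝ} (hb : 0 ≤ b) :
    ∫⁻ v in Ioi b, ENNReal.ofReal (1 / (1 + v ^ (α / 2))) =
      ENNReal.ofReal (∫ v in Ioi b, 1 / (1 + v ^ (α / 2))) := by
  rw [ofReal_integral_eq_lintegral_ofReal (integrableOn_one_div_one_add_rpow hα hb)]
  exact (ae_restrict_iff' measurableSet_Ioi).2 (ae_of_all _ (one_div_one_add_rpow_nonneg α hb))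

lemma lintegral_div_one_add_rpow (hα : 2 < α) {a b : ℝ} (ha : 0 < a) (hb : 0 ≤ b) :
    ∫⁻ v in Ioi b, ENNReal.ofReal (a * v ^ (-(α / 2)) / (1 + a * v ^ (-(α / 2)))) =
      ENNReal.ofReal (a ^ (2 / α) * ∫ v in Ioi (b / a ^ (2 / α)), 1 / (1 + v ^ (α / 2))) := by
  have hc : 0 < a ^ (2 / α) := Real.rpow_pos_of_pos ha _
  have hca : (a ^ (2 / α)) ^ (α / 2) = a := by
    rw [← Real.rpow_mul ha.le, div_mul_div_cancel₀' two_ne_zero, div_self (by positivity),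
      Real.rpow_one]
  have hscale : ∀ v ∈ Ioi (b / a ^ (2 / α)), ENNReal.ofReal
      (a * (a ^ (2 / α) * v) ^ (-(α / 2)) / (1 + a * (a ^ (2 / α) * v) ^ (-(α / 2)))) =
        ENNReal.ofReal (1 / (1 + v ^ (α / 2))) := fun v hv => by
    have hv : 0 < v := (div_nonneg hb hc.le).trans_lt hv
    have : 0 < v ^ (α / 2) := Real.rpow_pos_of_pos hv _
    rw [Real.rpow_neg (by positivity), Real.mul_rpow hc.le hv.le, hca]
    congr 1
    field_simp
    ring
  conv_lhs => rw [← mul_div_cancel₀ b hc.ne']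
  rw [setLIntegral_Ioi_mul_left hc _ (by fun_prop),
    setLIntegral_congr_fun measurableSet_Ioi hscale,
    lintegral_one_div_one_add_rpow hα (by positivity), ← ENNReal.ofReal_mul hc.le]

theorem setLIntegral_pathLoss (hα : 2 < α) {a t : ℝ} (ha : 0 ≤ a) (ht : 0 ≤ t) :
    ∫⁻ y in {y : Plane | t ≤ ‖y‖},
        ∫⁻ h, (1 - expNeg (ENNReal.ofReal (a * h * ‖y‖ ^ (-α)))) ∂(expMeasure 1) =
      ENNReal.ofReal (Real.pi * a ^ (2 / α) *
        ∫ v in Ioi (t ^ 2 / a ^ (2 / α)), 1 / (1 + v ^ (α / 2))) := by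
  rcases ha.eq_or_lt with rfl | ha
  · simp [Real.zero_rpow (show 2 / α ≠ 0 by positivity)]
  have hsq : ∀ y : Plane, ‖y‖ ^ (-α) = (‖y‖ ^ 2) ^ (-(α / 2)) := fun y => by
    rw [← Real.rpow_natCast, ← Real.rpow_mul (norm_nonneg y)]
    congr 1
    push_cast
    ring
  have hfading : ∀ y : Plane,
      ∫⁻ h, (1 - expNeg (ENNReal.ofReal (a * h * ‖y‖ ^ (-α)))) ∂(expMeasure 1) = ENNReal.ofReal
        (a * (‖y‖ ^ 2) ^ (-(α / 2)) / (1 + a * (‖y‖ ^ 2) ^ (-(α / 2)))) := fun y => by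
    rw [← hsq, ← lintegral_one_sub_expNeg_expMeasure one_pos (by positivity)]
    simp only [mul_right_comm]
  simp_rw [hfading]
  rw [setLIntegral_norm_sq
      (f := fun v => ENNReal.ofReal (a * v ^ (-(α / 2)) / (1 + a * v ^ (-(α / 2)))))
      (by fun_prop) ht,
    lintegral_div_one_add_rpow hα ha (sq_nonneg t), ← ENNReal.ofReal_mul Real.pi_pos.le, mul_assoc]

end PathLoss

/-! ### Void probabilities and general position -/

section GeneralPosition

lemma expNeg_tsum_indicator_top {ι E : Type*} (A : Set E) (z : ι → E) :
    expNeg (∑' n, A.indicator (fun _ => ∞) (z n)) = {z : ι → E | ∀ n, z n ∉ A}.indicator 1 z := by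
  by_cases h : ∀ n, z n ∉ A
  · simp [h]
  · rw [indicator_of_notMem (s := {z : ι → E | ∀ n, z n ∉ A}) h, expNeg_eq_zero, ← top_le_iff]
    push Not at h
    obtain ⟨n, hn⟩ := h
    exact (indicator_of_mem hn fun _ => (∞ : ℝ≥0∞)).ge.trans
      (ENNReal.le_tsum (f := fun n => A.indicator (fun _ => ∞) (z n)) n)

variable {Ω : Type*} [MeasurableSpace Ω] {P : Measure Ω} {X : ℕ → Ω → Plane} {lam : ℝ}

lemma measurableSet_forall_notMem {S : Type*} [MeasurableSpace S] {Y : ℕ → Ω → S}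
    (hY : ∀ n, Measurable (Y n)) {A : Set S} (hA : MeasurableSet A) :
    MeasurableSet {ω | ∀ n, Y n ω ∉ A} := by
  rw [ofPred_forall]
  exact MeasurableSet.iInter fun n => (hY n hA).compl

lemma volume_norm_sq_mem_Ico_le (a b : ℝ) :
    volume {y : Plane | ‖y‖ ^ 2 ∈ Ico a b} ≤
      ENNReal.ofReal Real.pi * ENNReal.ofReal (b - a) := by
  have hmap := Measure.map_apply (μ := volume)
    (show Measurable fun y : Plane => ‖y‖ ^ 2 by fun_prop) (measurableSet_Ico (a := a) (b := b))
  rw [map_norm_sq_volume, Measure.smul_apply, smul_eq_mul] at hmap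
  refine hmap.symm.trans_le (mul_le_mul_right ?_ _)
  exact (Measure.restrict_apply_le _ _).trans_eq Real.volume_Ico

variable [IsProbabilityMeasure P]

lemma IsPoissonProcess.measure_forall_notMem (hX : IsPoissonProcess P X lam) {A : Set Plane}
    (hA : MeasurableSet A) :
    P {ω | ∀ n, X n ω ∉ A} = expNeg (ENNReal.ofReal lam * volume A) := by
  have hu : Measurable (A.indicator fun _ => (∞ : ℝ≥0∞)) := measurable_const.indicator hA
  have hvoid : ∀ y, 1 - expNeg (A.indicator (fun _ => ∞) y) = A.indicator 1 y := fun y => by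
    by_cases hy : y ∈ A <;> simp [hy]
  calc P {ω | ∀ n, X n ω ∉ A}
      = ∫⁻ ω, {ω | ∀ n, X n ω ∉ A}.indicator 1 ω ∂P :=
        (lintegral_indicator_one (measurableSet_forall_notMem hX.measurable hA)).symm
    _ = ∫⁻ ω, expNeg (∑' n, A.indicator (fun _ => ∞) (X n ω)) ∂P :=
        lintegral_congr fun ω => (expNeg_tsum_indicator_top A fun n => X n ω).symm
    _ = expNeg (ENNReal.ofReal lam * volume A) := by
        simp_rw [hX.lintegral_expNeg_tsum hu, hvoid, lintegral_indicator_one hA]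

lemma IsPoissonProcess.measure_forall_notMem_marked (hX : IsPoissonProcess P X lam) {E : Type*}
    [MeasurableSpace E] {M : ℕ → Ω → E} {ν : Measure E} (hM : IsIndepMarking P X M ν)
    {A : Set (Plane × E)} (hA : MeasurableSet A) :
    P {ω | ∀ n, (X n ω, M n ω) ∉ A} =
      expNeg (ENNReal.ofReal lam * ∫⁻ y, ν {m | (y, m) ∈ A}) := by
  have hv : Measurable (A.indicator fun _ => (∞ : ℝ≥0∞)) := measurable_const.indicator hA
  have hvoid : ∀ y m, 1 - expNeg (A.indicator (fun _ => ∞) (y, m)) =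
      {m | (y, m) ∈ A}.indicator 1 m := fun y m => by
    by_cases hy : (y, m) ∈ A <;> simp [hy]
  have hmeas := measurableSet_forall_notMem
    (fun n => (hX.measurable n).prodMk (hM.measurable n)) hA
  calc P {ω | ∀ n, (X n ω, M n ω) ∉ A}
      = ∫⁻ ω, {ω | ∀ n, (X n ω, M n ω) ∉ A}.indicator 1 ω ∂P :=
        (lintegral_indicator_one hmeas).symm
    _ = ∫⁻ ω, expNeg (∑' n, A.indicator (fun _ => ∞) (X n ω, M n ω)) ∂P :=
        lintegral_congr fun ω => (expNeg_tsum_indicator_top A fun n => (X n ω, M n ω)).symm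
    _ = expNeg (ENNReal.ofReal lam * ∫⁻ y, ν {m | (y, m) ∈ A}) := by
        simp_rw [hX.lintegral_expNeg_tsum_marked hM hv, hvoid]
        congr 2
        exact lintegral_congr fun y => lintegral_indicator_one (measurable_prodMk_left hA)

lemma IsPoissonProcess.ae_forall_notMem (hX : IsPoissonProcess P X lam) {A : Set Plane}
    (hA : MeasurableSet A) (hA' : volume A = 0) : ∀ᵐ ω ∂P, ∀ n, X n ω ∉ A := by
  refine (mem_ae_iff_prob_eq_one (measurableSet_forall_notMem hX.measurable hA)).2 ?_
  simp [hX.measure_forall_notMem hA, hA']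

lemma IsPoissonProcess.ae_count_ne_top (hX : IsPoissonProcess P X lam) {A : Set Plane}
    (hA : MeasurableSet A) (hA' : volume A < ∞) : ∀ᵐ ω ∂P, count X A ω ≠ ⊤ := by
  refine ae_of_ae_map (p := fun j => j ≠ ⊤) (measurable_count hX.measurable hA).aemeasurable ?_
  rw [hX.map_count hA hA']
  refine (ae_map_iff (measurable_of_countable _).aemeasurable .of_discrete).2 ?_
  exact ae_of_all _ fun j => ENat.natCast_ne_top j

lemma IsPoissonProcess.ae_finite (hX : IsPoissonProcess P X lam) :
    ∀ᵐ ω ∂P, ∀ R : ℝ, {n | ‖X n ω‖ < R}.Finite := by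
  have hball : ∀ᵐ ω ∂P, ∀ K : ℕ, count X (Metric.ball 0 K) ω ≠ ⊤ := ae_all_iff.2 fun K =>
    hX.ae_count_ne_top Metric.isOpen_ball.measurableSet measure_ball_lt_top
  filter_upwards [hball] with ω hω R
  obtain ⟨K, hK⟩ := exists_nat_gt R
  refine (encard_ne_top_iff.1 (hω K)).subset fun n hn => ?_
  exact mem_ball_zero_iff.2 (lt_trans hn hK)

lemma IsPoissonProcess.measure_one_lt_count (hX : IsPoissonProcess P X lam) {A : Set Plane}
    (hA : MeasurableSet A) (hA' : volume A < ∞) :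
    P {ω | 1 < count X A ω} ≤ (ENNReal.ofReal lam * volume A) ^ 2 := by
  have hm := measurable_count hX.measurable hA
  set r : ℝ≥0 := (lam * (volume A).toReal).toNNReal with hr
  have hr' : ENNReal.ofReal lam * volume A = r := by
    rw [hr, ← ENNReal.ofReal_toReal hA'.ne, ← ENNReal.ofReal_mul' ENNReal.toReal_nonneg,
      ENNReal.toReal_ofReal ENNReal.toReal_nonneg]
    rfl
  have hmeas : ∀ j : ℕ, MeasurableSet {ω | count X A ω = j} := fun j =>
    hm (measurableSet_singleton _)
  have hdisj : Disjoint {ω | count X A ω = (0 : ℕ)} {ω | count X A ω = (1 : ℕ)} :=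
    Set.disjoint_left.2 fun ω (h0 : _ = _) (h1 : _ = _) => by simp [h0] at h1
  have hsub : {ω | 1 < count X A ω} ⊆
      ({ω | count X A ω = (0 : ℕ)} ∪ {ω | count X A ω = (1 : ℕ)})ᶜ := by
    rintro ω hω (h | h) <;> rw [mem_ofPred_eq] at hω h <;> rw [h] at hω <;> norm_num at hω
  have htail : 1 - (Real.exp (-r) + Real.exp (-r) * r) ≤ (r : ℝ) ^ 2 := by
    nlinarith [Real.add_one_le_exp (-r : ℝ), r.coe_nonneg]
  calc P {ω | 1 < count X A ω}
      ≤ 1 - (P {ω | count X A ω = (0 : ℕ)} + P {ω | count X A ω = (1 : ℕ)}) := by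
        rw [← measure_union hdisj (hmeas 1),
          ← prob_compl_eq_one_sub ((hmeas 0).union (hmeas 1))]
        exact measure_mono hsub
    _ = ENNReal.ofReal (1 - (Real.exp (-r) + Real.exp (-r) * r)) := by
        rw [hX.count_law A hA hA', hX.count_law A hA hA', poissonMeasure_singleton,
          poissonMeasure_singleton, ← hr, ← ENNReal.ofReal_add (by positivity) (by positivity),
          ← ENNReal.ofReal_one, ← ENNReal.ofReal_sub _ (by positivity)]
        simp
    _ ≤ ENNReal.ofReal ((r : ℝ) ^ 2) := ENNReal.ofReal_le_ofReal htail
    _ = (ENNReal.ofReal lam * volume A) ^ 2 := by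
        rw [hr', ENNReal.ofReal_pow r.coe_nonneg, ENNReal.ofReal_coe_nnreal]

lemma IsPoissonProcess.measure_exists_norm_eq_le (hX : IsPoissonProcess P X lam) {δ : ℝ}
    (hδ : 0 < δ) (n : ℕ) :
    P {ω | ∃ i j, i ≠ j ∧ ‖X i ω‖ = ‖X j ω‖ ∧ ‖X i ω‖ ^ 2 < n * δ} ≤
      n * (ENNReal.ofReal lam * (ENNReal.ofReal Real.pi * ENNReal.ofReal δ)) ^ 2 := by
  let A : ℕ → Set Plane := fun k => {y : Plane | ‖y‖ ^ 2 ∈ Ico (k * δ) ((k + 1) * δ)}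
  have hA : ∀ k, MeasurableSet (A k) := fun k =>
    (show Measurable fun y : Plane => ‖y‖ ^ 2 by fun_prop) measurableSet_Ico
  have hvol : ∀ k, volume (A k) ≤ ENNReal.ofReal Real.pi * ENNReal.ofReal δ := fun k =>
    (volume_norm_sq_mem_Ico_le _ _).trans_eq (by rw [add_one_mul, add_sub_cancel_left])
  have hvol' : ∀ k, volume (A k) < ∞ := fun k =>
    (hvol k).trans_lt (ENNReal.mul_lt_top (by simp) (by simp))
  have hcover : {ω | ∃ i j, i ≠ j ∧ ‖X i ω‖ = ‖X j ω‖ ∧ ‖X i ω‖ ^ 2 < n * δ} ⊆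
      ⋃ k ∈ Finset.range n, {ω | 1 < count X (A k) ω} := by
    rintro ω ⟨i, j, hne, hij, hlt⟩
    have hq : 0 ≤ ‖X i ω‖ ^ 2 / δ := by positivity
    have hmem : X i ω ∈ A ⌊‖X i ω‖ ^ 2 / δ⌋₊ :=
      ⟨(le_div_iff₀ hδ).1 (Nat.floor_le hq), (div_lt_iff₀ hδ).1 (Nat.lt_floor_add_one _)⟩
    have hmem' : X j ω ∈ A ⌊‖X i ω‖ ^ 2 / δ⌋₊ := by
      simpa only [A, mem_ofPred_eq, hij] using hmem
    refine mem_biUnion (x := ⌊‖X i ω‖ ^ 2 / δ⌋₊) ?_ (one_lt_encard_iff.2 ⟨i, j, hmem, hmem', hne⟩)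
    rw [Finset.mem_coe, Finset.mem_range, Nat.floor_lt hq]
    exact (div_lt_iff₀ hδ).2 hlt
  refine (measure_mono hcover).trans ((measure_biUnion_finset_le _ _).trans ?_)
  refine (Finset.sum_le_card_nsmul _ _ _ fun k _ => ?_).trans_eq
    (by rw [Finset.card_range, nsmul_eq_mul])
  exact (hX.measure_one_lt_count (hA k) (hvol' k)).trans (by gcongr; exact hvol k)

lemma IsPoissonProcess.measure_exists_norm_eq_of_lt (hX : IsPoissonProcess P X lam) (K : ℕ) :
    P {ω | ∃ i j, i ≠ j ∧ ‖X i ω‖ = ‖X j ω‖ ∧ ‖X i ω‖ ^ 2 < K} = 0 := by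
  set C : ℝ≥0∞ := K * (ENNReal.ofReal lam * ENNReal.ofReal Real.pi) ^ 2
  have hC : C ≠ ∞ := by finiteness
  have hbound : ∀ m : ℕ, 0 < m →
      P {ω | ∃ i j, i ≠ j ∧ ‖X i ω‖ = ‖X j ω‖ ∧ ‖X i ω‖ ^ 2 < K} ≤ C * (m : ℝ≥0∞)⁻¹ := by
    intro m hm
    have hm' : (0 : ℝ) < m := Nat.cast_pos.2 hm
    have hcancel : (m : ℝ≥0∞) * (m : ℝ≥0∞)⁻¹ = 1 :=
      ENNReal.mul_inv_cancel (by simpa using hm.ne') (ENNReal.natCast_ne_top m)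
    have hmesh := hX.measure_exists_norm_eq_le (inv_pos.2 hm') (K * m)
    rw [Nat.cast_mul, mul_assoc, mul_inv_cancel₀ hm'.ne', mul_one] at hmesh
    refine hmesh.trans_eq ?_
    calc _ = C * (m * (m : ℝ≥0∞)⁻¹) * (m : ℝ≥0∞)⁻¹ := by
          rw [ENNReal.ofReal_inv_of_pos hm', ENNReal.ofReal_natCast]
          push_cast
          ring
      _ = C * (m : ℝ≥0∞)⁻¹ := by rw [hcancel, mul_one]
  have hlim : Tendsto (fun m : ℕ => C * (m : ℝ≥0∞)⁻¹) atTop (𝓝 0) := by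
    simpa using ENNReal.Tendsto.const_mul ENNReal.tendsto_inv_nat_nhds_zero (Or.inr hC)
  exact le_antisymm (ge_of_tendsto hlim ((eventually_gt_atTop 0).mono hbound)) zero_le

lemma IsPoissonProcess.ae_norm_injective (hX : IsPoissonProcess P X lam) :
    ∀ᵐ ω ∂P, Function.Injective fun n => ‖X n ω‖ := by
  have hdisk : ∀ᵐ ω ∂P, ∀ K : ℕ, ¬ ∃ i j, i ≠ j ∧ ‖X i ω‖ = ‖X j ω‖ ∧ ‖X i ω‖ ^ 2 < K :=
    ae_all_iff.2 fun K => ae_iff.2 (by simpa only [not_not] using hX.measure_exists_norm_eq_of_lt K)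
  filter_upwards [hdisk] with ω hω i j hij
  obtain ⟨K, hK⟩ := exists_nat_gt (‖X i ω‖ ^ 2)
  by_contra hne
  exact hω K ⟨i, j, hne, hij, hK⟩

end GeneralPosition

/-! ### The power of a buyer BS -/

section BuyerPower

lemma indep_of_le_iSup {Ω ι : Type*} {m : ι → MeasurableSpace Ω} {mΩ : MeasurableSpace Ω}
    {P : Measure Ω} (hle : ∀ i, m i ≤ mΩ) (hm : iIndep m P) {S T : Set ι} (hST : Disjoint S T)
    {m₁ m₂ : MeasurableSpace Ω} (h₁ : m₁ ≤ ⨆ i ∈ S, m i) (h₂ : m₂ ≤ ⨆ i ∈ T, m i) :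
    Indep m₁ m₂ P :=
  indep_of_indep_of_le (indep_iSup_of_disjoint hle hm hST) h₁ h₂

lemma markedSigma_le_of_le {Ω S E : Type*} [MeasurableSpace S] [mE : MeasurableSpace E]
    {X : ℕ → Ω → S} {M : ℕ → Ω → E} {n : ℕ} {𝓐 : MeasurableSpace Ω} (hX : pointSigma X ≤ 𝓐)
    (hM : ∀ j < n, mE.comap (M j) ≤ 𝓐) : markedSigma X M n ≤ 𝓐 :=
  sup_le hX (iSup₂_le fun j hj => hM j hj)

lemma ae_pos_of_map_eq_expMeasure {Ω : Type*} [MeasurableSpace Ω] {P : Measure Ω} {h : Ω → ℝ}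
    {r : ℝ} (hr : 0 < r) (hm : Measurable h) (hlaw : P.map h = expMeasure r) :
    ∀ᵐ ω ∂P, 0 < h ω :=
  ae_of_ae_map (p := fun h => 0 < h) hm.aemeasurable (by rw [hlaw]; exact expMeasure_ae_pos hr)

lemma ofReal_le_lintegral_expMeasure_lt_mul_rpow (x : Plane) {α δ : ℝ} (hα : 0 ≤ α)
    (hδ : 0 < δ) :
    ENNReal.ofReal (Real.exp (-1) * (Real.pi * δ ^ 2)) ≤
      ∫⁻ y : Plane, expMeasure 1 {h | δ ^ (-α) < h * ‖x - y‖ ^ (-α)} := by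
  have hgain : expMeasure 1 {h | 1 < h} = ENNReal.ofReal (Real.exp (-1)) := by
    simpa only [ENNReal.one_lt_ofReal, ENNReal.ofReal_one, one_mul, expNeg_eq_ofReal_exp
      ENNReal.one_ne_top, ENNReal.toReal_one] using expMeasure_setOf_lt_ofReal one_pos 1
  have hne : ∀ᵐ y : Plane, y ≠ x := by simp [ae_iff]
  calc ENNReal.ofReal (Real.exp (-1) * (Real.pi * δ ^ 2))
      = ∫⁻ _ in Metric.closedBall x δ, expMeasure 1 {h | 1 < h} := by
        rw [setLIntegral_const, EuclideanSpace.volume_closedBall_fin_two, hgain,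
          ← ENNReal.ofReal_pow hδ.le, ← ENNReal.ofReal_mul (by positivity),
          ← ENNReal.ofReal_mul (by positivity), mul_comm Real.pi]
    _ ≤ ∫⁻ y in Metric.closedBall x δ, expMeasure 1 {h | δ ^ (-α) < h * ‖x - y‖ ^ (-α)} := by
        refine setLIntegral_mono_ae' Metric.isClosed_closedBall.measurableSet ?_
        filter_upwards [hne] with y hy hyδ
        refine measure_mono fun h (hh : 1 < h) => ?_
        have hpos : 0 < ‖x - y‖ := norm_pos_iff.2 (sub_ne_zero.2 hy.symm)
        have hle : ‖x - y‖ ≤ δ := by rwa [← dist_eq_norm, dist_comm]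
        calc δ ^ (-α) ≤ ‖x - y‖ ^ (-α) :=
              Real.rpow_le_rpow_of_nonpos hpos hle (neg_nonpos.2 hα)
          _ < h * ‖x - y‖ ^ (-α) := lt_mul_of_one_lt_left (Real.rpow_pos_of_pos hpos _) hh
    _ ≤ _ := setLIntegral_le_lintegral _ _

variable {MNO Band Ω : Type*} [DecidableEq MNO] {N : Network MNO Band}
  {F : Randomness MNO Band Ω} {s : MNO} {l : Band} {x : Plane}

lemma ueGain_mul_rpow_le_of_lt_buyerPower (hζ : 0 < N.threshold s) {u : ℝ} (hu : 0 < u) {ω : Ω}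
    (h : u < buyerPower N F s l x ω) (i : ℕ) :
    F.ueGain l i ω * ‖x - F.ue s i ω‖ ^ (-N.α) ≤ N.threshold s / u := by
  have hpos : 0 < maxGain N F s l x ω := (div_pos_iff_of_pos_left hζ).1 (hu.trans h)
  have hbdd : BddAbove (range fun i => F.ueGain l i ω * ‖x - F.ue s i ω‖ ^ (-N.α)) := by
    by_contra hb
    exact hpos.ne' (Real.iSup_of_not_bddAbove hb)
  calc F.ueGain l i ω * ‖x - F.ue s i ω‖ ^ (-N.α) ≤ maxGain N F s l x ω := le_ciSup hbdd i
    _ ≤ N.threshold s / u := ((lt_div_comm₀ hu hpos).1 h).le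

variable [MeasurableSpace Ω] {P : Measure Ω}

lemma IsModel.isIndepMarking_ueGain (hF : IsModel P N F s l x) :
    IsIndepMarking P (F.ue s) (F.ueGain l) (expMeasure 1) := by
  refine ⟨hF.ueGain_measurable, hF.ueGain_law, fun n => ?_⟩
  have hle : ∀ i, UESource.sigma F s l i ≤ ‹MeasurableSpace Ω› := by
    rintro (_ | i)
    · exact (measurable_pi_lambda _ hF.ue_poisson.measurable).comap_le
    · exact (hF.ueGain_measurable i).comap_le
  have hsub : ∀ {T : Set UESource} {i}, i ∈ T →
      UESource.sigma F s l i ≤ ⨆ i ∈ T, UESource.sigma F s l i := fun {T i} hi =>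
    le_iSup₂ (f := fun i (_ : i ∈ T) => UESource.sigma F s l i) i hi
  refine indep_of_le_iSup hle hF.ue_indep (S := {.gain n}) (T := {.gain n}ᶜ)
    disjoint_compl_right (hsub (i := .gain n) rfl) (markedSigma_le_of_le (hsub (i := .ue) ?_)
      fun j hj => hsub (i := .gain j) ?_)
  · simp
  · simpa using hj.ne

lemma IsModel.measurable_buyerPower (hF : IsModel P N F s l x) :
    Measurable (buyerPower N F s l x) := by
  refine Measurable.const_div (Measurable.iSup fun i => (hF.ueGain_measurable i).mul ?_) _
  exact ((measurable_const.sub (hF.ue_poisson.measurable i)).norm).pow_const _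

lemma IsModel.ae_buyerPower_nonneg (hF : IsModel P N F s l x) (hζ : 0 ≤ N.threshold s) :
    ∀ᵐ ω ∂P, 0 ≤ buyerPower N F s l x ω := by
  have hgain := ae_all_iff.2 fun i =>
    ae_pos_of_map_eq_expMeasure one_pos (hF.ueGain_measurable i) (hF.ueGain_law i)
  filter_upwards [hgain] with ω hω
  exact div_nonneg hζ (Real.iSup_nonneg fun i =>
    mul_nonneg (hω i).le (Real.rpow_nonneg (norm_nonneg _) _))

variable [IsProbabilityMeasure P]

-- Every UE within distance `δ` with gain above `1` keeps the power below `ζ * δ ^ α`, so the tail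
-- is at most the void probability of a disk.
lemma IsModel.measure_lt_buyerPower_le (hF : IsModel P N F s l x) (hζ : 0 < N.threshold s)
    {δ : ℝ} (hδ : 0 < δ) :
    P {ω | N.threshold s * δ ^ N.α < buyerPower N F s l x ω} ≤
      expNeg (ENNReal.ofReal (N.ueIntensity s) *
        ENNReal.ofReal (Real.exp (-1) * (Real.pi * δ ^ 2))) := by
  set A : Set (Plane × ℝ) := {q | δ ^ (-N.α) < q.2 * ‖x - q.1‖ ^ (-N.α)}
  have hA : MeasurableSet A := measurableSet_lt measurable_const
    (measurable_snd.mul ((measurable_const.sub measurable_fst).norm.pow_const _))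
  have hvoid : {ω | N.threshold s * δ ^ N.α < buyerPower N F s l x ω} ⊆
      {ω | ∀ n, (F.ue s n ω, F.ueGain l n ω) ∉ A} := fun ω hω n => by
    refine LE.le.not_gt (b := δ ^ (-N.α)) ?_
    refine (ueGain_mul_rpow_le_of_lt_buyerPower hζ (by positivity) hω n).trans_eq ?_
    rw [Real.rpow_neg hδ.le, div_mul_cancel_left₀ hζ.ne']
  calc P {ω | N.threshold s * δ ^ N.α < buyerPower N F s l x ω}
      ≤ expNeg (ENNReal.ofReal (N.ueIntensity s) * ∫⁻ y, expMeasure 1 {h | (y, h) ∈ A}) :=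
        (measure_mono hvoid).trans_eq
          (hF.ue_poisson.measure_forall_notMem_marked hF.isIndepMarking_ueGain hA)
    _ ≤ _ := by
        refine expNeg_antitone (mul_le_mul_right ?_ _)
        exact ofReal_le_lintegral_expMeasure_lt_mul_rpow x (two_pos.trans N.two_lt_α).le hδ

lemma IsModel.measure_lt_buyerPower_rpow_le (hF : IsModel P N F s l x) (hζ : 0 < N.threshold s)
    {w : ℝ} (hw : 0 < w) :
    P {ω | w < buyerPower N F s l x ω ^ (2 / N.α)} ≤
      expNeg (ENNReal.ofReal (N.ueIntensity s) *
        ENNReal.ofReal (Real.exp (-1) * (Real.pi * (w / N.threshold s ^ (2 / N.α))))) := by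
  have hα : 0 < N.α := two_pos.trans N.two_lt_α
  have hq : 0 < w / N.threshold s ^ (2 / N.α) := by positivity
  have hpow : N.threshold s * √(w / N.threshold s ^ (2 / N.α)) ^ N.α = w ^ (N.α / 2) := by
    rw [Real.sqrt_eq_rpow, ← Real.rpow_mul hq.le, Real.div_rpow hw.le (by positivity),
      ← Real.rpow_mul hζ.le, show 2 / N.α * (1 / 2 * N.α) = 1 by field_simp, Real.rpow_one,
      mul_div_cancel₀ _ hζ.ne', one_div_mul_eq_div]
  have htail := hF.measure_lt_buyerPower_le hζ (Real.sqrt_pos.2 hq)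
  rw [hpow, Real.sq_sqrt hq.le] at htail
  refine (measure_mono_ae ?_).trans htail
  filter_upwards [hF.ae_buyerPower_nonneg hζ.le] with ω hω (h : w < _)
  rw [← inv_div] at h
  exact (Real.lt_rpow_inv_iff_of_pos hw.le hω (half_pos hα)).1 h

theorem IsModel.integrable_buyerPower_rpow (hF : IsModel P N F s l x) (hμ : 0 < N.ueIntensity s)
    (hζ : 0 < N.threshold s) :
    Integrable (fun ω => buyerPower N F s l x ω ^ (2 / N.α)) P := by
  have hmeas : Measurable fun ω => buyerPower N F s l x ω ^ (2 / N.α) :=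
    hF.measurable_buyerPower.pow_const _
  have hnonneg : 0 ≤ᵐ[P] fun ω => buyerPower N F s l x ω ^ (2 / N.α) := by
    filter_upwards [hF.ae_buyerPower_nonneg hζ.le] with ω hω using Real.rpow_nonneg hω _
  set c := N.ueIntensity s * (Real.exp (-1) * (Real.pi / N.threshold s ^ (2 / N.α))) with hc
  have hc0 : 0 < c := by positivity
  have htail : ∀ w ∈ Ioi (0 : ℝ), P {ω | w < buyerPower N F s l x ω ^ (2 / N.α)} ≤
      ENNReal.ofReal (Real.exp (-c * w)) := fun w (hw : 0 < w) => by
    refine (hF.measure_lt_buyerPower_rpow_le hζ hw).trans_eq ?_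
    rw [← ENNReal.ofReal_mul hμ.le, expNeg_ofReal (by positivity)]
    congr 2
    rw [hc]
    ring
  rw [← lintegral_ofReal_ne_top_iff_integrable hmeas.aestronglyMeasurable hnonneg,
    lintegral_eq_lintegral_meas_lt P hnonneg hmeas.aemeasurable]
  exact ne_top_of_le_ne_top (exp_neg_integrableOn_Ioi 0 hc0).lintegral_lt_top.ne
    (setLIntegral_mono' measurableSet_Ioi htail)

end BuyerPower

/-! ### Independent operators -/

section Sources

variable {MNO Band Ω : Type*} {F : Randomness MNO Band Ω} {l : Band}

/-- The marks of the BSs of a buyer: transmit power and channel gain. -/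
def buyerMark (F : Randomness MNO Band Ω) (l : Band) (b : MNO) (n : ℕ) (ω : Ω) : ℝ × ℝ :=
  (F.power l b n ω, F.gain l b n ω)

lemma comap_buyerMark_le {b : MNO} {n : ℕ} {𝓐 : MeasurableSpace Ω}
    (hpower : MeasurableSpace.comap (F.power l b n) inferInstance ≤ 𝓐)
    (hgain : MeasurableSpace.comap (F.gain l b n) inferInstance ≤ 𝓐) :
    MeasurableSpace.comap (buyerMark F l b n) inferInstance ≤ 𝓐 :=
  Measurable.comap_le
    (Measurable.prodMk (measurable_iff_comap_le.2 hpower) (measurable_iff_comap_le.2 hgain))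

variable [DecidableEq MNO] {N : Network MNO Band} {s : MNO} {x : Plane}

/-- The MNO to which a source of randomness belongs. -/
def Source.mno : Source N s l → MNO
  | .bs k => k
  | .gain k _ => k
  | .power k _ => k

/-- The σ-algebra of all the randomness that belongs to an MNO. -/
@[reducible] def mnoSigma (N : Network MNO Band) (F : Randomness MNO Band Ω) (s : MNO) (l : Band)
    (k : MNO) : MeasurableSpace Ω :=
  ⨆ i ∈ {i : Source N s l | i.mno = k}, Source.sigma F i

lemma Source.sigma_le_iSup {T : Set (Source N s l)} {i : Source N s l} (hi : i ∈ T) :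
    Source.sigma F i ≤ ⨆ i ∈ T, Source.sigma F i :=
  le_iSup₂ (f := fun i (_ : i ∈ T) => Source.sigma F i) i hi

lemma measurable_bs_mnoSigma {k : MNO} (hk : k ∈ N.group l) (n : ℕ) :
    Measurable[mnoSigma N F s l k] (F.bs k n) :=
  (measurable_pointSigma (F.bs k) n).mono
    (Source.sigma_le_iSup (i := (.bs ⟨k, hk⟩ : Source N s l)) rfl) le_rfl

lemma measurable_gain_mnoSigma {k : MNO} (hk : k ∈ N.group l) (n : ℕ) :
    Measurable[mnoSigma N F s l k] (F.gain l k n) :=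
  (comap_measurable (F.gain l k n)).mono
    (Source.sigma_le_iSup (i := (.gain ⟨k, hk⟩ n : Source N s l)) rfl) le_rfl

lemma measurable_buyerMark_mnoSigma {b : MNO} (hb : b ∈ (N.group l).erase s) (n : ℕ) :
    Measurable[mnoSigma N F s l b] (buyerMark F l b n) :=
  Measurable.prodMk
    ((comap_measurable (F.power l b n)).mono
      (Source.sigma_le_iSup (i := (.power ⟨b, hb⟩ n : Source N s l)) rfl) le_rfl)
    (measurable_gain_mnoSigma (Finset.mem_of_mem_erase hb) n)

variable [MeasurableSpace Ω] {P : Measure Ω}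

lemma IsModel.source_le (hF : IsModel P N F s l x) (i : Source N s l) :
    Source.sigma F i ≤ ‹MeasurableSpace Ω› := by
  rcases i with k | ⟨k, n⟩ | ⟨k, n⟩
  · exact (measurable_pi_lambda _ (hF.bs_poisson k k.2).measurable).comap_le
  · exact (hF.gain_measurable k k.2 n).comap_le
  · exact (hF.power_measurable k k.2 n).comap_le

lemma IsModel.mnoSigma_le (hF : IsModel P N F s l x) (k : MNO) :
    mnoSigma N F s l k ≤ ‹MeasurableSpace Ω› :=
  iSup₂_le fun i _ => hF.source_le i

lemma IsModel.isIndepMarking_gain (hF : IsModel P N F s l x) {k : MNO} (hk : k ∈ N.group l) :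
    IsIndepMarking P (F.bs k) (F.gain l k) (expMeasure 1) := by
  refine ⟨hF.gain_measurable k hk, hF.gain_law k hk, fun n => ?_⟩
  refine indep_of_le_iSup hF.source_le hF.indep (S := {.gain ⟨k, hk⟩ n}) (T := {.gain ⟨k, hk⟩ n}ᶜ)
    disjoint_compl_right (Source.sigma_le_iSup (i := .gain ⟨k, hk⟩ n) rfl)
    (markedSigma_le_of_le (Source.sigma_le_iSup (i := .bs ⟨k, hk⟩) ?_)
      fun j hj => Source.sigma_le_iSup (i := .gain ⟨k, hk⟩ j) ?_)
  · simp
  · simpa using hj.ne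

lemma IsModel.indep_buyerMark (hF : IsModel P N F s l x) {b : MNO} (hb : b ∈ (N.group l).erase s)
    (n : ℕ) :
    Indep (MeasurableSpace.comap (buyerMark F l b n) inferInstance)
      (markedSigma (F.bs b) (buyerMark F l b) n) P := by
  have hb' := Finset.mem_of_mem_erase hb
  let S : Set (Source N s l) := {.power ⟨b, hb⟩ n, .gain ⟨b, hb'⟩ n}
  refine indep_of_le_iSup hF.source_le hF.indep (S := S) (T := Sᶜ) disjoint_compl_right
    (comap_buyerMark_le (Source.sigma_le_iSup (i := .power ⟨b, hb⟩ n) (Or.inl rfl))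
      (Source.sigma_le_iSup (i := .gain ⟨b, hb'⟩ n) (Or.inr rfl)))
    (markedSigma_le_of_le (Source.sigma_le_iSup (i := .bs ⟨b, hb'⟩) ?_)
      fun j hj => comap_buyerMark_le (Source.sigma_le_iSup (i := .power ⟨b, hb⟩ j) ?_)
        (Source.sigma_le_iSup (i := .gain ⟨b, hb'⟩ j) ?_))
  · simp [S]
  · simpa [S] using hj.ne
  · simpa [S] using hj.ne

lemma IsModel.lintegral_mul_prod_mno (hF : IsModel P N F s l x) {T : Finset MNO} {a : MNO}
    (ha : a ∉ T) {A : Ω → ℝ≥0∞} (hA : Measurable[mnoSigma N F s l a] A) {B : MNO → Ω → ℝ≥0∞}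
    (hB : ∀ k ∈ T, Measurable[mnoSigma N F s l k] (B k)) :
    ∫⁻ ω, A ω * ∏ k ∈ T, B k ω ∂P = (∫⁻ ω, A ω ∂P) * ∫⁻ ω, ∏ k ∈ T, B k ω ∂P := by
  have hle : ∀ k ∈ T, mnoSigma N F s l k ≤
      ⨆ i ∈ {i : Source N s l | i.mno ∈ T}, Source.sigma F i := fun k hk =>
    biSup_mono fun i (hi : i.mno = k) => by rwa [mem_ofPred_eq, hi]
  have hdisj : Disjoint {i : Source N s l | i.mno = a} {i | i.mno ∈ T} :=
    Set.disjoint_left.2 fun i (h : i.mno = a) (h' : i.mno ∈ T) => ha (h ▸ h')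
  exact lintegral_mul_eq_lintegral_mul_lintegral_of_independent_measurableSpace
    (hF.mnoSigma_le a) (iSup₂_le fun i _ => hF.source_le i)
    (indep_iSup_of_disjoint hF.source_le hF.indep hdisj) hA
    (Finset.measurable_prod _ fun k hk => (hB k hk).mono (hle k hk) le_rfl)

variable [IsProbabilityMeasure P]

lemma IsModel.isIndepMarking_buyerMark (hF : IsModel P N F s l x) {b : MNO}
    (hb : b ∈ (N.group l).erase s) :
    IsIndepMarking P (F.bs b) (buyerMark F l b)
      ((P.map (buyerPower N F s l x)).prod (expMeasure 1)) := by
  have hb' := Finset.mem_of_mem_erase hb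
  have hpower := hF.power_measurable b hb
  have hgain := hF.gain_measurable b hb'
  refine ⟨fun n => (hpower n).prodMk (hgain n), fun n => ?_, hF.indep_buyerMark hb⟩
  have hindep : IndepFun (F.power l b n) (F.gain l b n) P := by
    rw [IndepFun_iff_Indep]
    exact hF.indep.indep (i := .power ⟨b, hb⟩ n) (j := .gain ⟨b, hb'⟩ n) (by simp)
  rw [← (hF.power_law b hb n).map_eq, ← hF.gain_law b hb' n]
  exact (indepFun_iff_map_prod_eq_prod_map_map (hpower n).aemeasurable
    (hgain n).aemeasurable).1 hindep

lemma IsModel.lintegral_prod_mno (hF : IsModel P N F s l x) (T : Finset MNO)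
    {B : MNO → Ω → ℝ≥0∞} (hB : ∀ k ∈ T, Measurable[mnoSigma N F s l k] (B k)) :
    ∫⁻ ω, ∏ k ∈ T, B k ω ∂P = ∏ k ∈ T, ∫⁻ ω, B k ω ∂P := by
  induction T using Finset.induction_on with
  | empty => simp
  | insert a T ha ih =>
    have hB' : ∀ k ∈ T, Measurable[mnoSigma N F s l k] (B k) := fun k hk =>
      hB k (Finset.mem_insert_of_mem hk)
    simp_rw [Finset.prod_insert ha]
    rw [← ih hB', hF.lintegral_mul_prod_mno ha (hB a (Finset.mem_insert_self _ _)) hB']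

end Sources

/-! ### The Laplace transform of the interference -/

section PathLoss

/-- The power received at the origin from a transmitter at `y` of power `p` through a channel of
gain `h`, with path loss exponent `α`. -/
def rxPower (α p h : ℝ) (y : Plane) : ℝ≥0∞ :=
  ENNReal.ofReal (p * h * ‖y‖ ^ (-α))

lemma measurable_rxPower {Ω : Type*} {m : MeasurableSpace Ω} (α : ℝ) {p h : Ω → ℝ} {y : Ω → Plane}
    (hp : Measurable p) (hh : Measurable h) (hy : Measurable y) :
    Measurable fun ω => rxPower α (p ω) (h ω) (y ω) := by
  unfold rxPower
  fun_prop

lemma measurable_indicator_rxPower (α p t : ℝ) : Measurable fun q : Plane × ℝ =>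
    {y | t ≤ ‖y‖}.indicator (rxPower α p q.2) q.1 :=
  Measurable.indicator (s := {q : Plane × ℝ | t ≤ ‖q.1‖})
    (measurable_rxPower α measurable_const measurable_snd measurable_fst)
    (measurableSet_le measurable_const measurable_fst.norm)

lemma ofReal_mul_rxPower (α p h : ℝ) (y : Plane) {θ : ℝ} (hθ : 0 ≤ θ) :
    ENNReal.ofReal θ * rxPower α p h y = rxPower α (θ * p) h y := by
  rw [rxPower, ← ENNReal.ofReal_mul hθ, rxPower, ← mul_assoc, ← mul_assoc]

variable {α : ℝ}

lemma lintegral_one_sub_expNeg_ball_add_rxPower (hα : 2 < α) {p r t : ℝ} (hp : 0 ≤ p)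
    (hr : 0 ≤ r) (hrt : r ≤ t) :
    ∫⁻ y, ∫⁻ h, (1 - expNeg ((Metric.ball 0 r).indicator (fun _ => ∞) y +
        {y | t ≤ ‖y‖}.indicator (rxPower α p h) y)) ∂(expMeasure 1) =
      ENNReal.ofReal (Real.pi * r ^ 2 + Real.pi * p ^ (2 / α) *
        ∫ v in Ioi (t ^ 2 / p ^ (2 / α)), 1 / (1 + v ^ (α / 2))) := by
  have := isProbabilityMeasure_expMeasure one_pos
  have hsplit : ∀ y : Plane, ∫⁻ h, (1 - expNeg ((Metric.ball 0 r).indicator (fun _ => ∞) y +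
        {y | t ≤ ‖y‖}.indicator (rxPower α p h) y)) ∂(expMeasure 1) =
      (Metric.ball 0 r).indicator 1 y + {y | t ≤ ‖y‖}.indicator
        (fun y => ∫⁻ h, (1 - expNeg (rxPower α p h y)) ∂(expMeasure 1)) y := by
    intro y
    by_cases hy : ‖y‖ < r
    · simp [indicator, hy, (hy.trans_le hrt).not_ge]
    · by_cases hyt : t ≤ ‖y‖ <;> simp [indicator, hy, hyt]
  have hfar := setLIntegral_pathLoss hα hp (hr.trans hrt)
  have hI := integral_one_div_one_add_rpow_nonneg α (b := t ^ 2 / p ^ (2 / α)) (by positivity)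
  simp_rw [hsplit]
  rw [lintegral_add_left (measurable_one.indicator Metric.isOpen_ball.measurableSet),
    lintegral_indicator_one Metric.isOpen_ball.measurableSet,
    lintegral_indicator (measurableSet_le measurable_const measurable_norm),
    EuclideanSpace.volume_ball_fin_two, ← ENNReal.ofReal_pow hr,
    ← ENNReal.ofReal_mul (by positivity), mul_comm (r ^ 2),
    ENNReal.ofReal_add (by positivity) (by positivity)]
  simp only [rxPower, hfar]

lemma lintegral_one_sub_expNeg_rxPower (hα : 2 < α) {ν : Measure ℝ} [IsProbabilityMeasure ν]
    (hν : ∀ᵐ p ∂ν, 0 ≤ p) (hint : Integrable (fun p => p ^ (2 / α)) ν) {θ : ℝ} (hθ : 0 ≤ θ) :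
    ∫⁻ y, ∫⁻ m, (1 - expNeg (rxPower α (θ * m.1) m.2 y)) ∂(ν.prod (expMeasure 1)) =
      ENNReal.ofReal (Real.pi * θ ^ (2 / α) * (∫ p, p ^ (2 / α) ∂ν) * rhoInfty α) := by
  have := isProbabilityMeasure_expMeasure one_pos
  have hmeas : Measurable fun q : (Plane × ℝ) × ℝ =>
      1 - expNeg (rxPower α (θ * q.1.2) q.2 q.1.1) :=
    measurable_const.sub (measurable_expNeg.comp
      (measurable_rxPower α (by fun_prop) measurable_snd (by fun_prop)))
  have hρ := rhoInfty_nonneg α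
  have hpoint : ∀ p, 0 ≤ p →
      ∫⁻ y, ∫⁻ h, (1 - expNeg (rxPower α (θ * p) h y)) ∂(expMeasure 1) =
        ENNReal.ofReal (Real.pi * θ ^ (2 / α) * rhoInfty α) * ENNReal.ofReal (p ^ (2 / α)) := by
    intro p hp
    have h := setLIntegral_pathLoss hα (mul_nonneg hθ hp) le_rfl
    rw [zero_pow two_ne_zero, zero_div, ← rhoInfty, Real.mul_rpow hθ hp] at h
    simp only [norm_nonneg, ofPred_true, setLIntegral_univ] at h
    rw [← ENNReal.ofReal_mul (by positivity)]
    refine h.trans (congrArg _ ?_)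
    ring
  calc ∫⁻ y, ∫⁻ m, (1 - expNeg (rxPower α (θ * m.1) m.2 y)) ∂(ν.prod (expMeasure 1))
      = ∫⁻ y, ∫⁻ p, ∫⁻ h, (1 - expNeg (rxPower α (θ * p) h y)) ∂(expMeasure 1) ∂ν :=
        lintegral_congr fun y => lintegral_prod _
          (hmeas.comp (f := fun m : ℝ × ℝ => ((y, m.1), m.2)) (by fun_prop)).aemeasurable
    _ = ∫⁻ p, (∫⁻ y, ∫⁻ h, (1 - expNeg (rxPower α (θ * p) h y)) ∂(expMeasure 1)) ∂ν :=
        lintegral_lintegral_swap hmeas.lintegral_prod_right'.aemeasurable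
    _ = ∫⁻ p, ENNReal.ofReal (Real.pi * θ ^ (2 / α) * rhoInfty α) *
          ENNReal.ofReal (p ^ (2 / α)) ∂ν :=
        lintegral_congr_ae (hν.mono hpoint)
    _ = ENNReal.ofReal (Real.pi * θ ^ (2 / α) * (∫ p, p ^ (2 / α) ∂ν) * rhoInfty α) := by
        rw [lintegral_const_mul _ (by fun_prop), ← ofReal_integral_eq_lintegral_ofReal hint
          (hν.mono fun p hp => Real.rpow_nonneg hp _), ← ENNReal.ofReal_mul (by positivity)]
        congr 1
        ring

end PathLoss

section Interference

lemma measurable_tsum_marked {Ω S E : Type*} {_ : MeasurableSpace Ω} [MeasurableSpace S]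
    [MeasurableSpace E] {X : ℕ → Ω → S} {M : ℕ → Ω → E} (hX : ∀ n, Measurable (X n))
    (hM : ∀ n, Measurable (M n)) {v : S × E → ℝ≥0∞} (hv : Measurable v) :
    Measurable fun ω => ∑' n, v (X n ω, M n ω) :=
  Measurable.tsum fun n => hv.comp ((hX n).prodMk (hM n))

variable {MNO Band Ω : Type*} [DecidableEq MNO] {N : Network MNO Band}
  {F : Randomness MNO Band Ω} {s : MNO} {l : Band} {x : Plane}

/-- The interference at the typical UE from the BSs of the seller at distance at least `t`. -/
def sellerFar (N : Network MNO Band) (F : Randomness MNO Band Ω) (s : MNO) (l : Band) (t : ℝ)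
    (ω : Ω) : ℝ≥0∞ :=
  ∑' n, {y | t ≤ ‖y‖}.indicator (rxPower N.α N.sellerPower (F.gain l s n ω)) (F.bs s n ω)

/-- The interference at the typical UE from the BSs of the buyer `b`. -/
def buyerInterference (N : Network MNO Band) (F : Randomness MNO Band Ω) (l : Band) (b : MNO)
    (ω : Ω) : ℝ≥0∞ :=
  ∑' n, rxPower N.α (F.power l b n ω) (F.gain l b n ω) (F.bs b n ω)

/-- The interference at the typical UE from the BSs of the seller at distance at least `t` and
from all BSs of the buyers. For `t` slightly above the serving distance it is almost surely the
interference. -/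
def farInterference (N : Network MNO Band) (F : Randomness MNO Band Ω) (s : MNO) (l : Band)
    (t : ℝ) (ω : Ω) : ℝ≥0∞ :=
  sellerFar N F s l t ω + ∑ b ∈ (N.group l).erase s, buyerInterference N F l b ω

lemma measurable_sellerFar {_ : MeasurableSpace Ω} (hX : ∀ n, Measurable (F.bs s n))
    (hg : ∀ n, Measurable (F.gain l s n)) (t : ℝ) : Measurable (sellerFar N F s l t) :=
  measurable_tsum_marked hX hg (measurable_indicator_rxPower N.α N.sellerPower t)

lemma measurable_buyerInterference {m : MeasurableSpace Ω} {b : MNO}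
    (hX : ∀ n, Measurable (F.bs b n)) (hM : ∀ n, Measurable (buyerMark F l b n)) :
    Measurable (buyerInterference N F l b) :=
  measurable_tsum_marked (v := fun q => rxPower N.α q.2.1 q.2.2 q.1) hX hM
    (measurable_rxPower N.α (by fun_prop) (by fun_prop) measurable_fst)

lemma measurable_void_mul_expNeg_sellerFar {_ : MeasurableSpace Ω}
    (hX : ∀ n, Measurable (F.bs s n)) (hg : ∀ n, Measurable (F.gain l s n)) (θ r t : ℝ) :
    Measurable fun ω => {ω | ∀ n, F.bs s n ω ∉ Metric.ball 0 r}.indicator (1 : Ω → ℝ≥0∞) ω *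
      expNeg (ENNReal.ofReal θ * sellerFar N F s l t ω) :=
  (measurable_one.indicator
    (measurableSet_forall_notMem hX Metric.isOpen_ball.measurableSet)).mul
    (measurable_expNeg.comp (measurable_const.mul (measurable_sellerFar hX hg t)))

lemma expNeg_ball_add_sellerFar {r t θ : ℝ} (hθ : 0 ≤ θ) (ω : Ω) :
    expNeg (∑' n, ((Metric.ball 0 r).indicator (fun _ => ∞) (F.bs s n ω) +
        {y | t ≤ ‖y‖}.indicator (rxPower N.α (θ * N.sellerPower) (F.gain l s n ω))
          (F.bs s n ω))) =
      {ω | ∀ n, F.bs s n ω ∉ Metric.ball 0 r}.indicator 1 ω *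
        expNeg (ENNReal.ofReal θ * sellerFar N F s l t ω) := by
  rw [ENNReal.tsum_add, expNeg_add,
    expNeg_tsum_indicator_top (Metric.ball 0 r) (fun n => F.bs s n ω), sellerFar,
    ← ENNReal.tsum_mul_left]
  congr 2
  refine tsum_congr fun n => ?_
  by_cases hn : t ≤ ‖F.bs s n ω‖ <;> simp [indicator, hn, ofReal_mul_rxPower _ _ _ _ hθ]

variable [MeasurableSpace Ω] {P : Measure Ω}

lemma IsModel.powerMoment_nonneg (hF : IsModel P N F s l x) (hζ : 0 ≤ N.threshold s) :
    0 ≤ powerMoment P N F s l x := by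
  refine integral_nonneg_of_ae ?_
  filter_upwards [hF.ae_buyerPower_nonneg hζ] with ω hω using Real.rpow_nonneg hω _

variable [IsProbabilityMeasure P]

lemma IsModel.lintegral_void_mul_expNeg_sellerFar (hF : IsModel P N F s l x)
    (hs : s ∈ N.group l) (hlam : 0 ≤ N.bsIntensity s) {θ r t : ℝ} (hθ : 0 ≤ θ) (hr : 0 ≤ r)
    (hrt : r ≤ t) :
    ∫⁻ ω, {ω | ∀ n, F.bs s n ω ∉ Metric.ball 0 r}.indicator 1 ω *
        expNeg (ENNReal.ofReal θ * sellerFar N F s l t ω) ∂P =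
      ENNReal.ofReal (Real.exp (-(N.bsIntensity s * (Real.pi * r ^ 2 +
        Real.pi * (θ * N.sellerPower) ^ (2 / N.α) *
          ∫ v in Ioi (t ^ 2 / (θ * N.sellerPower) ^ (2 / N.α)), 1 / (1 + v ^ (N.α / 2)))))) := by
  have hp : 0 ≤ θ * N.sellerPower := mul_nonneg hθ N.sellerPower_pos.le
  have hI := integral_one_div_one_add_rpow_nonneg N.α
    (b := t ^ 2 / (θ * N.sellerPower) ^ (2 / N.α)) (by positivity)
  have hv : Measurable fun q : Plane × ℝ => (Metric.ball 0 r).indicator (fun _ => ∞) q.1 +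
      {y | t ≤ ‖y‖}.indicator (rxPower N.α (θ * N.sellerPower) q.2) q.1 :=
    ((measurable_const.indicator Metric.isOpen_ball.measurableSet).comp measurable_fst).add
      (measurable_indicator_rxPower _ _ _)
  simp_rw [← expNeg_ball_add_sellerFar hθ]
  rw [(hF.bs_poisson s hs).lintegral_expNeg_tsum_marked (hF.isIndepMarking_gain hs) hv,
    lintegral_one_sub_expNeg_ball_add_rxPower N.two_lt_α hp hr hrt, ← ENNReal.ofReal_mul hlam,
    expNeg_ofReal (by positivity)]

lemma IsModel.lintegral_expNeg_buyerInterference (hF : IsModel P N F s l x)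
    (hμ : 0 < N.ueIntensity s) (hζ : 0 < N.threshold s) {b : MNO}
    (hb : b ∈ (N.group l).erase s) (hlam : 0 ≤ N.bsIntensity b) {θ : ℝ} (hθ : 0 ≤ θ) :
    ∫⁻ ω, expNeg (ENNReal.ofReal θ * buyerInterference N F l b ω) ∂P =
      ENNReal.ofReal (Real.exp (-(N.bsIntensity b *
        (Real.pi * θ ^ (2 / N.α) * powerMoment P N F s l x * rhoInfty N.α)))) := by
  have hpower := hF.measurable_buyerPower
  have := Measure.isProbabilityMeasure_map (μ := P) hpower.aemeasurable
  have hnonneg : ∀ᵐ p ∂(P.map (buyerPower N F s l x)), 0 ≤ p :=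
    (ae_map_iff hpower.aemeasurable measurableSet_Ici).2 (hF.ae_buyerPower_nonneg hζ.le)
  have hpow : Measurable fun p : ℝ => p ^ (2 / N.α) := by fun_prop
  have hint : Integrable (fun p => p ^ (2 / N.α)) (P.map (buyerPower N F s l x)) :=
    (integrable_map_measure hpow.aestronglyMeasurable hpower.aemeasurable).2
      (hF.integrable_buyerPower_rpow hμ hζ)
  have hM := hF.powerMoment_nonneg hζ.le
  have hρ := rhoInfty_nonneg N.α
  simp_rw [buyerInterference, ← ENNReal.tsum_mul_left, ofReal_mul_rxPower _ _ _ _ hθ]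
  refine ((hF.bs_poisson b (Finset.mem_of_mem_erase hb)).lintegral_expNeg_tsum_marked
    (v := fun q => rxPower N.α (θ * q.2.1) q.2.2 q.1) (hF.isIndepMarking_buyerMark hb)
    (measurable_rxPower _ (by fun_prop) (by fun_prop) measurable_fst)).trans ?_
  rw [lintegral_one_sub_expNeg_rxPower N.two_lt_α hnonneg hint hθ,
    integral_map hpower.aemeasurable hpow.aestronglyMeasurable, ← powerMoment,
    ← ENNReal.ofReal_mul hlam, expNeg_ofReal (by positivity)]

lemma IsModel.lintegral_void_mul_expNeg_farInterference (hF : IsModel P N F s l x)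
    (hs : s ∈ N.group l) (hlam : ∀ k ∈ N.group l, 0 ≤ N.bsIntensity k)
    (hμ : 0 < N.ueIntensity s) (hζ : 0 < N.threshold s) {θ r t : ℝ} (hθ : 0 ≤ θ) (hr : 0 ≤ r)
    (hrt : r ≤ t) :
    ∫⁻ ω, {ω | ∀ n, F.bs s n ω ∉ Metric.ball 0 r}.indicator 1 ω *
        expNeg (ENNReal.ofReal θ * farInterference N F s l t ω) ∂P =
      ENNReal.ofReal (Real.exp (-(N.bsIntensity s * (Real.pi * r ^ 2))) *
        (Real.exp (-(N.bsIntensity s * (Real.pi * (θ * N.sellerPower) ^ (2 / N.α) *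
          ∫ v in Ioi (t ^ 2 / (θ * N.sellerPower) ^ (2 / N.α)), 1 / (1 + v ^ (N.α / 2))))) *
        Real.exp (-(Real.pi * buyerIntensity N s l * powerMoment P N F s l x * θ ^ (2 / N.α) *
          rhoInfty N.α)))) := by
  have hbuyer : ∀ b ∈ (N.group l).erase s, Measurable[mnoSigma N F s l b] fun ω =>
      expNeg (ENNReal.ofReal θ * buyerInterference N F l b ω) := fun b hb =>
    measurable_expNeg.comp (measurable_const.mul (measurable_buyerInterference
      (measurable_bs_mnoSigma (Finset.mem_of_mem_erase hb)) (measurable_buyerMark_mnoSigma hb)))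
  have hlaw : ∀ b ∈ (N.group l).erase s,
      ∫⁻ ω, expNeg (ENNReal.ofReal θ * buyerInterference N F l b ω) ∂P = _ := fun b hb =>
    hF.lintegral_expNeg_buyerInterference hμ hζ hb (hlam b (Finset.mem_of_mem_erase hb)) hθ
  simp_rw [farInterference, mul_add, expNeg_add, Finset.mul_sum, expNeg_sum, ← mul_assoc]
  rw [hF.lintegral_mul_prod_mno (Finset.notMem_erase s _)
      (measurable_void_mul_expNeg_sellerFar (measurable_bs_mnoSigma hs)
        (measurable_gain_mnoSigma hs) θ r t) hbuyer,
    hF.lintegral_void_mul_expNeg_sellerFar hs (hlam s hs) hθ hr hrt,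
    hF.lintegral_prod_mno _ hbuyer, Finset.prod_congr rfl hlaw,
    ← ENNReal.ofReal_prod_of_nonneg fun _ _ => (Real.exp_pos _).le, ← Real.exp_sum,
    Finset.sum_neg_distrib, ← Finset.sum_mul, ← buyerIntensity,
    ← ENNReal.ofReal_mul (Real.exp_pos _).le, ← Real.exp_add, ← Real.exp_add, ← Real.exp_add]
  congr 2
  ring

end Interference

/-! ### The serving base station -/

section Serving

lemma measurable_nat_sInf {Ω : Type*} {m : MeasurableSpace Ω} {S : Ω → Set ℕ}
    (hS : ∀ n, MeasurableSet {ω | n ∈ S ω}) : Measurable fun ω => sInf (S ω) := by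
  refine measurable_of_Iic fun n => ?_
  have hset : (fun ω => sInf (S ω)) ⁻¹' Iic n =
      (⋃ k ∈ Iic n, {ω | k ∈ S ω}) ∪ ⋂ k, {ω | k ∈ S ω}ᶜ := by
    ext ω
    simp only [mem_preimage, mem_Iic, mem_union, mem_iUnion, mem_iInter, mem_compl_iff,
      mem_ofPred_eq, exists_prop]
    constructor
    · intro h
      rcases (S ω).eq_empty_or_nonempty with hempty | hne
      · exact Or.inr fun k hk => by simp [hempty] at hk
      · exact Or.inl ⟨_, h, Nat.sInf_mem hne⟩
    · rintro (⟨k, hkn, hk⟩ | hempty)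
      · exact (Nat.sInf_le hk).trans hkn
      · simp [eq_empty_of_forall_notMem hempty]
  rw [hset]
  exact (MeasurableSet.biUnion (to_countable _) fun k _ => hS k).union
    (MeasurableSet.iInter fun k => (hS k).compl)

lemma measurable_comp_nat {Ω E : Type*} {_ : MeasurableSpace Ω} [MeasurableSpace E] {J : Ω → ℕ}
    {g : ℕ → Ω → E} (hJ : Measurable J) (hg : ∀ j, Measurable (g j)) :
    Measurable fun ω => g (J ω) ω :=
  (measurable_from_prod_countable_right (f := fun q : ℕ × Ω => g q.1 q.2) hg).comp
    (hJ.prodMk measurable_id)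

/-- A configuration of points in general position: locally finite, no point at the origin, and no
two points at the same distance from the origin. -/
structure InGeneralPosition (z : ℕ → Plane) : Prop where
  ne_zero : ∀ n, z n ≠ 0
  finite : ∀ R : ℝ, {n | ‖z n‖ < R}.Finite
  norm_injective : Function.Injective fun n => ‖z n‖

lemma IsPoissonProcess.ae_inGeneralPosition {Ω : Type*} [MeasurableSpace Ω] {P : Measure Ω}
    [IsProbabilityMeasure P] {X : ℕ → Ω → Plane} {lam : ℝ} (hX : IsPoissonProcess P X lam) :
    ∀ᵐ ω ∂P, InGeneralPosition fun n => X n ω := by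
  filter_upwards [hX.ae_forall_notMem (measurableSet_singleton 0) (by simp), hX.ae_finite,
    hX.ae_norm_injective] with ω hzero hfinite hinj
  exact ⟨hzero, hfinite, hinj⟩

variable {MNO Band Ω : Type*} [DecidableEq MNO] {N : Network MNO Band}
  {F : Randomness MNO Band Ω} {s : MNO}

lemma measurable_servingBS {m : MeasurableSpace Ω} (hX : ∀ n, Measurable (F.bs s n)) :
    Measurable (servingBS N F s) := by
  have hrx : ∀ n, Measurable (meanRxPower N F s n) := fun n =>
    measurable_const.mul ((measurable_norm.comp (hX n)).pow_const _)
  refine measurable_nat_sInf fun n => ?_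
  exact (MeasurableSet.iInter fun m => measurableSet_le (hrx m) (hrx n)).congr (by ext; simp)

lemma measurable_servingDist {_ : MeasurableSpace Ω} (hX : ∀ n, Measurable (F.bs s n)) :
    Measurable (servingDist N F s) :=
  measurable_norm.comp (measurable_comp_nat (measurable_servingBS hX) hX)

lemma servingDist_nonneg (ω : Ω) : 0 ≤ servingDist N F s ω := norm_nonneg _

lemma InGeneralPosition.servingDist_lt {ω : Ω} (h : InGeneralPosition fun n => F.bs s n ω) {m : ℕ}
    (hm : m ≠ servingBS N F s ω) : servingDist N F s ω < ‖F.bs s m ω‖ := by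
  have hα := N.two_lt_α
  have hle : ∀ m n, meanRxPower N F s m ω ≤ meanRxPower N F s n ω ↔
      ‖F.bs s n ω‖ ≤ ‖F.bs s m ω‖ := fun m n => by
    rw [meanRxPower, meanRxPower, mul_le_mul_iff_right₀ N.sellerPower_pos,
      Real.rpow_le_rpow_iff_of_neg (norm_pos_iff.2 (h.ne_zero m)) (norm_pos_iff.2 (h.ne_zero n))
        (by linarith)]
  have hne : {n | ∀ m, meanRxPower N F s m ω ≤ meanRxPower N F s n ω}.Nonempty := by
    obtain ⟨n, hn, hmin⟩ := Set.exists_min_image _ (fun n => ‖F.bs s n ω‖)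
      (h.finite (‖F.bs s 0 ω‖ + 1)) ⟨0, by simp⟩
    refine ⟨n, fun m => (hle m n).2 ?_⟩
    by_cases hm : ‖F.bs s m ω‖ < ‖F.bs s 0 ω‖ + 1
    · exact hmin m hm
    · exact (le_of_lt hn).trans (not_lt.1 hm)
  exact lt_of_le_of_ne ((hle m _).1 (Nat.sInf_mem hne m)) fun he => hm (h.norm_injective he).symm

lemma InGeneralPosition.servingDist_le {ω : Ω} (h : InGeneralPosition fun n => F.bs s n ω)
    (m : ℕ) : servingDist N F s ω ≤ ‖F.bs s m ω‖ := by
  by_cases hm : m = servingBS N F s ω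
  · rw [hm, servingDist]
  · exact (h.servingDist_lt hm).le

lemma InGeneralPosition.forall_notMem_ball_iff {ω : Ω}
    (h : InGeneralPosition fun n => F.bs s n ω) {r : ℝ} :
    (∀ n, F.bs s n ω ∉ Metric.ball 0 r) ↔ r ≤ servingDist N F s ω := by
  simp only [mem_ball_zero_iff, not_lt]
  exact ⟨fun hr => hr _, fun hr n => hr.trans (h.servingDist_le n)⟩

end Serving

section Finiteness

lemma ae_lt_top_of_lintegral_expNeg_eq {Ω : Type*} [MeasurableSpace Ω] {P : Measure Ω}
    [IsProbabilityMeasure P] {S : Ω → ℝ≥0∞} (hS : Measurable S) {g : ℝ → ℝ}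
    (hg : ContinuousAt g 0) (hg0 : g 0 = 1)
    (h : ∀ θ > 0, ∫⁻ ω, expNeg (ENNReal.ofReal θ * S ω) ∂P = ENNReal.ofReal (g θ)) :
    ∀ᵐ ω ∂P, S ω < ∞ := by
  have hfin : MeasurableSet {ω | S ω < ∞} := measurableSet_lt hS measurable_const
  have hle : ∀ θ > 0, ENNReal.ofReal (g θ) ≤ P {ω | S ω < ∞} := fun θ hθ => by
    rw [← h θ hθ, ← lintegral_indicator_one hfin]
    refine lintegral_mono fun ω => ?_
    by_cases hω : S ω < ∞
    · simpa [hω] using expNeg_le_one _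
    · simp [not_lt_top_iff.1 hω, ENNReal.mul_top, hθ]
  have hlim : Tendsto (fun θ => ENNReal.ofReal (g θ)) (𝓝[>] 0) (𝓝 1) := by
    simpa [hg0] using (ENNReal.tendsto_ofReal hg.tendsto).mono_left nhdsWithin_le_nhds
  exact (mem_ae_iff_prob_eq_one hfin).2 (le_antisymm prob_le_one
    (le_of_tendsto hlim (eventually_mem_nhdsWithin.mono hle)))

variable {MNO Band Ω : Type*} [DecidableEq MNO] {N : Network MNO Band}
  {F : Randomness MNO Band Ω} {s : MNO} {l : Band} {x : Plane}

lemma Network.bsIntensity_pos_of_mem_group (hs : s ∈ N.sellers) (hl : l ∈ N.bands s) {k : MNO}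
    (hk : k ∈ N.group l) : 0 < N.bsIntensity k := by
  refine N.bsIntensity_pos k (Finset.mem_union.2 ?_)
  by_cases hks : k = s
  · exact Or.inl (hks ▸ hs)
  · exact Or.inr (N.group_subset s hs l hl (Finset.mem_erase.2 ⟨hks, hk⟩))

lemma Network.ueIntensity_pos_of_mem_sellers (hs : s ∈ N.sellers) : 0 < N.ueIntensity s :=
  N.ueIntensity_pos s (Finset.mem_union_left _ hs)

/-- The interference at the typical UE if the BS of the seller with number `j` is the serving
one. -/
def interferenceExcept (N : Network MNO Band) (F : Randomness MNO Band Ω) (s : MNO) (l : Band)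
    (j : ℕ) (ω : Ω) : ℝ≥0∞ :=
  (∑' n, {n | n ≠ j}.indicator
    (fun n => rxPower N.α N.sellerPower (F.gain l s n ω) (F.bs s n ω)) n) +
    ∑ b ∈ (N.group l).erase s, buyerInterference N F l b ω

lemma interference_eq_interferenceExcept (ω : Ω) :
    interference N F s l ω = interferenceExcept N F s l (servingBS N F s ω) ω :=
  congrArg (· + _) (tsum_subtype {n | n ≠ servingBS N F s ω} fun n =>
    rxPower N.α N.sellerPower (F.gain l s n ω) (F.bs s n ω))

lemma interferenceExcept_le_farInterference (j : ℕ) (ω : Ω) :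
    interferenceExcept N F s l j ω ≤ farInterference N F s l 0 ω := by
  refine add_le_add_left (ENNReal.tsum_le_tsum fun n => ?_) _
  rw [indicator_of_mem (s := {y : Plane | 0 ≤ ‖y‖}) (norm_nonneg _)]
  exact indicator_le_self _ _ n

lemma measurable_interferenceExcept {m : MeasurableSpace Ω} {j : ℕ}
    (hX : ∀ n, Measurable (F.bs s n)) (hg : ∀ n ≠ j, Measurable (F.gain l s n))
    (hB : ∀ b ∈ (N.group l).erase s, Measurable (buyerInterference N F l b)) :
    Measurable (interferenceExcept N F s l j) := by
  refine Measurable.add (Measurable.tsum fun n => ?_) (Finset.measurable_sum _ hB)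
  by_cases hn : n = j
  · simp [hn]
  · simpa [hn] using measurable_rxPower N.α measurable_const (hg n hn) (hX n)

variable [MeasurableSpace Ω] {P : Measure Ω}

lemma IsModel.measurable_buyerInterference (hF : IsModel P N F s l x) {b : MNO}
    (hb : b ∈ (N.group l).erase s) : Measurable (buyerInterference N F l b) :=
  have hb' := Finset.mem_of_mem_erase hb
  SpectrumSharing.measurable_buyerInterference (hF.bs_poisson b hb').measurable fun n =>
    (hF.power_measurable b hb n).prodMk (hF.gain_measurable b hb' n)

lemma IsModel.measurable_farInterference (hF : IsModel P N F s l x) (hs : s ∈ N.group l) (t : ℝ) :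
    Measurable (farInterference N F s l t) :=
  (measurable_sellerFar (hF.bs_poisson s hs).measurable (hF.gain_measurable s hs) t).add
    (Finset.measurable_sum _ fun _ hb => hF.measurable_buyerInterference hb)

lemma IsModel.measurable_interference (hF : IsModel P N F s l x) (hs : s ∈ N.group l) :
    Measurable (interference N F s l) := by
  rw [funext interference_eq_interferenceExcept]
  have hX := (hF.bs_poisson s hs).measurable
  exact measurable_comp_nat (measurable_servingBS hX) fun j => measurable_interferenceExcept hX
    (fun n _ => hF.gain_measurable s hs n) fun _ hb => hF.measurable_buyerInterference hb

variable [IsProbabilityMeasure P]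

theorem IsModel.ae_interference_lt_top (hF : IsModel P N F s l x) (hs : s ∈ N.sellers)
    (hl : l ∈ N.bands s) : ∀ᵐ ω ∂P, interference N F s l ω < ∞ := by
  have hmem := N.seller_mem_group s hs l hl
  have hα : 0 < 2 / N.α := div_pos two_pos (two_pos.trans N.two_lt_α)
  have hpow : Continuous fun θ : ℝ => θ ^ (2 / N.α) :=
    continuous_id.rpow_const fun _ => Or.inr hα.le
  have : Continuous fun θ : ℝ => (θ * N.sellerPower) ^ (2 / N.α) :=
    hpow.comp (continuous_mul_const _)
  let g : ℝ → ℝ := fun θ =>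
    Real.exp (-(N.bsIntensity s * (Real.pi * (θ * N.sellerPower) ^ (2 / N.α) *
      rhoInfty N.α))) *
    Real.exp (-(Real.pi * buyerIntensity N s l * powerMoment P N F s l x * θ ^ (2 / N.α) *
      rhoInfty N.α))
  have hg : Continuous g := by fun_prop
  have hlaplace : ∀ θ > 0, ∫⁻ ω, expNeg (ENNReal.ofReal θ * farInterference N F s l 0 ω) ∂P =
      ENNReal.ofReal (g θ) := fun θ hθ => by
    have h := hF.lintegral_void_mul_expNeg_farInterference hmem
      (fun _ hk => (N.bsIntensity_pos_of_mem_group hs hl hk).le)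
      (N.ueIntensity_pos_of_mem_sellers hs) (N.threshold_pos s hs) hθ.le le_rfl (le_refl 0)
    simpa [g, rhoInfty] using h
  filter_upwards [ae_lt_top_of_lintegral_expNeg_eq (hF.measurable_farInterference hmem 0)
    hg.continuousAt (by simp [g, hα.ne']) hlaplace] with ω hω
  rw [interference_eq_interferenceExcept]
  exact (interferenceExcept_le_farInterference _ ω).trans_lt hω

end Finiteness

/-! ### Discretising the serving distance -/

section Grid

/-- The right end of the cell of the grid of mesh `1 / (k + 1)` that contains `r ≥ 0`. -/
def gridAbove (k : ℕ) (r : ℝ) : ℝ := (⌊r * (k + 1)⌋₊ + 1) / (k + 1)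

lemma lt_gridAbove (k : ℕ) (r : ℝ) : r < gridAbove k r := by
  rw [gridAbove, lt_div_iff₀ (by positivity)]
  exact Nat.lt_floor_add_one _

lemma gridAbove_le (k : ℕ) {r : ℝ} (hr : 0 ≤ r) : gridAbove k r ≤ r + 1 / ((k : ℝ) + 1) := by
  rw [gridAbove, div_le_iff₀ (by positivity), add_mul, one_div_mul_cancel (by positivity)]
  have := Nat.floor_le (show 0 ≤ r * ((k : ℝ) + 1) by positivity)
  linarith

lemma gridAbove_le_add_one (k : ℕ) {r : ℝ} (hr : 0 ≤ r) : gridAbove k r ≤ r + 1 :=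
  (gridAbove_le k hr).trans (add_le_add_right
    (by simpa using Nat.one_div_le_one_div (α := ℝ) k.zero_le) r)

lemma tendsto_gridAbove {r : ℝ} (hr : 0 ≤ r) : Tendsto (fun k => gridAbove k r) atTop (𝓝 r) := by
  refine tendsto_of_tendsto_of_tendsto_of_le_of_le tendsto_const_nhds ?_
    (fun k => (lt_gridAbove k r).le) (fun k => gridAbove_le k hr)
  simpa using (tendsto_one_div_add_atTop_nhds_zero_nat (𝕜 := ℝ)).const_add r

lemma measurable_gridIndex (k : ℕ) : Measurable fun r : ℝ => ⌊r * ((k : ℝ) + 1)⌋₊ :=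
  Nat.measurable_floor.comp (measurable_id.mul_const _)

lemma measurable_gridAbove (k : ℕ) : Measurable (gridAbove k) :=
  ((measurable_of_countable ((↑) : ℕ → ℝ)).comp (measurable_gridIndex k)).add_const 1 |>.div_const _

variable {Ω : Type*} [MeasurableSpace Ω] {P : Measure Ω}

lemma lintegral_comp_nat {J : Ω → ℕ} (hJ : Measurable J) (g : ℕ → Ω → ℝ≥0∞) :
    ∫⁻ ω, g (J ω) ω ∂P = ∑' j, ∫⁻ ω in J ⁻¹' {j}, g j ω ∂P := by
  have hS : ∀ j, MeasurableSet (J ⁻¹' {j}) := fun j => hJ (measurableSet_singleton j)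
  rw [← setLIntegral_univ, ← preimage_univ (f := J), ← iUnion_of_singleton, preimage_iUnion,
    lintegral_iUnion hS (pairwise_disjoint_fiber J)]
  exact tsum_congr fun j => setLIntegral_congr_fun (hS j) fun ω (hω : J ω = j) => by rw [hω]

lemma tendsto_lintegral_gridAbove_mul [IsFiniteMeasure P] {D : Ω → ℝ} (hD : Measurable D)
    (hD0 : ∀ ω, 0 ≤ D ω) (φ : BoundedContinuousFunction ℝ ℝ≥0) {f : ℕ → Ω → ℝ≥0∞}
    (hf : ∀ k, Measurable (f k)) (hf1 : ∀ k ω, f k ω ≤ 1) {g : Ω → ℝ≥0∞}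
    (hfg : ∀ᵐ ω ∂P, Tendsto (fun k => f k ω) atTop (𝓝 (g ω))) :
    Tendsto (fun k => ∫⁻ ω, φ (gridAbove k (D ω)) * f k ω ∂P) atTop
      (𝓝 (∫⁻ ω, φ (D ω) * g ω ∂P)) := by
  have hφ : Continuous fun r => (φ r : ℝ≥0∞) := ENNReal.continuous_coe.comp φ.continuous
  have hbound : ∀ r, (φ r : ℝ≥0∞) ≤ nndist φ 0 := fun r =>
    ENNReal.coe_le_coe.2 (BoundedContinuousFunction.NNReal.upper_bound φ r)
  refine tendsto_lintegral_of_dominated_convergence (fun _ => nndist φ 0)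
    (fun k => (hφ.measurable.comp ((measurable_gridAbove k).comp hD)).mul (hf k))
    (fun k => ae_of_all _ fun ω => (mul_le_mul' (hbound _) (hf1 k ω)).trans_eq (mul_one _))
    (by simp [ENNReal.mul_eq_top]) ?_
  filter_upwards [hfg] with ω hω
  have hg1 : g ω ≤ 1 := le_of_tendsto' hω fun k => hf1 k ω
  exact ENNReal.Tendsto.mul ((hφ.tendsto _).comp (tendsto_gridAbove (hD0 ω)))
    (Or.inr (ne_top_of_le_ne_top ENNReal.one_ne_top hg1)) hω (Or.inr ENNReal.coe_ne_top)

end Grid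

section LaplaceFormula

variable {MNO Band Ω : Type*} [DecidableEq MNO] {N : Network MNO Band}

/-- The point `κ = β x₀ ^ α / Pˢ` at which the Laplace transform of the interference is taken when
the serving distance is `x₀ = t`. -/
def laplaceArgument (N : Network MNO Band) (β t : ℝ) : ℝ := β * t ^ N.α / N.sellerPower

lemma continuous_laplaceArgument (N : Network MNO Band) (β : ℝ) :
    Continuous (laplaceArgument N β) := by
  have hpow : Continuous fun t : ℝ => t ^ N.α :=
    continuous_id.rpow_const fun _ => Or.inr (two_pos.trans N.two_lt_α).le
  exact (hpow.const_mul β).div_const _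

lemma laplaceArgument_nonneg {β t : ℝ} (hβ : 0 ≤ β) (ht : 0 ≤ t) : 0 ≤ laplaceArgument N β t :=
  div_nonneg (mul_nonneg hβ (Real.rpow_nonneg ht _)) N.sellerPower_pos.le

lemma laplaceArgument_mul_sellerPower_rpow {β t : ℝ} (hβ : 0 ≤ β) (ht : 0 ≤ t) :
    (laplaceArgument N β t * N.sellerPower) ^ (2 / N.α) = β ^ (2 / N.α) * t ^ 2 := by
  have hα : N.α ≠ 0 := (two_pos.trans N.two_lt_α).ne'
  rw [laplaceArgument, div_mul_cancel₀ _ N.sellerPower_pos.ne',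
    Real.mul_rpow hβ (Real.rpow_nonneg ht _), ← Real.rpow_mul ht, mul_div_cancel₀ _ hα,
    Real.rpow_two]

lemma sq_div_laplaceArgument_mul_sellerPower_rpow {β t : ℝ} (hβ : 0 ≤ β) (ht : 0 < t) :
    t ^ 2 / (laplaceArgument N β t * N.sellerPower) ^ (2 / N.α) = β ^ (-2 / N.α) := by
  rw [laplaceArgument_mul_sellerPower_rpow hβ ht.le, neg_div, Real.rpow_neg hβ, ← div_div,
    div_right_comm, div_self (pow_pos ht 2).ne', one_div]

variable {F : Randomness MNO Band Ω} {s : MNO} {l : Band} {x : Plane} [MeasurableSpace Ω]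
  {P : Measure Ω}

lemma continuous_laplaceFormula (P : Measure Ω) (N : Network MNO Band) (F : Randomness MNO Band Ω)
    (s : MNO) (l : Band) (x : Plane) (β : ℝ) : Continuous (laplaceFormula P N F s l x β) := by
  have hpow : Continuous fun κ : ℝ => κ ^ (2 / N.α) := continuous_id.rpow_const fun _ =>
    Or.inr (div_nonneg two_pos.le (two_pos.trans N.two_lt_α).le)
  unfold laplaceFormula
  fun_prop

lemma laplaceFormula_nonneg (β κ : ℝ) : 0 ≤ laplaceFormula P N F s l x β κ := by
  unfold laplaceFormula
  positivity

lemma IsModel.laplaceFormula_le_one (hF : IsModel P N F s l x) (hs : s ∈ N.sellers)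
    (hl : l ∈ N.bands s) {β κ : ℝ} (hβ : 0 ≤ β) (hκ : 0 ≤ κ) :
    laplaceFormula P N F s l x β κ ≤ 1 := by
  have hp := N.sellerPower_pos
  have hM := hF.powerMoment_nonneg (N.threshold_pos s hs).le
  have hρ := rho_nonneg N.α hβ
  have hρ' := rhoInfty_nonneg N.α
  have hlam : ∀ k ∈ N.group l, 0 ≤ N.bsIntensity k := fun _ hk =>
    (N.bsIntensity_pos_of_mem_group hs hl hk).le
  have hseller := hlam s (N.seller_mem_group s hs l hl)
  have hbuyer : 0 ≤ buyerIntensity N s l :=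
    Finset.sum_nonneg fun b hb => hlam b (Finset.mem_of_mem_erase hb)
  refine mul_le_one₀ (Real.exp_le_one_iff.2 ?_) (Real.exp_pos _).le (Real.exp_le_one_iff.2 ?_) <;>
    exact neg_nonpos.2 (by positivity)

end LaplaceFormula

section FarFactor

variable {MNO Band Ω : Type*} [DecidableEq MNO] {N : Network MNO Band}
  {F : Randomness MNO Band Ω} {s : MNO} {l : Band} {x : Plane}

/-- The exponential of minus `laplaceArgument N β t` times `farInterference N F s l t`, whose mean
given the serving distance is sought as `t` decreases to that distance. -/
def farFactor (N : Network MNO Band) (F : Randomness MNO Band Ω) (s : MNO) (l : Band) (β t : ℝ)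
    (ω : Ω) : ℝ≥0∞ :=
  expNeg (ENNReal.ofReal (laplaceArgument N β t) * farInterference N F s l t ω)

lemma InGeneralPosition.eventually_farInterference_gridAbove {ω : Ω}
    (h : InGeneralPosition fun n => F.bs s n ω) :
    ∀ᶠ k in atTop, farInterference N F s l (gridAbove k (servingDist N F s ω)) ω =
      interference N F s l ω := by
  set r := servingDist N F s ω
  have hr : 0 ≤ r := servingDist_nonneg ω
  have hnear : ∀ᶠ k in atTop, ∀ n ∈ {n | ‖F.bs s n ω‖ < r + 1},
      n ≠ servingBS N F s ω → gridAbove k r ≤ ‖F.bs s n ω‖ := by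
    refine (h.finite (r + 1)).eventually_all.2 fun n _ => ?_
    by_cases hn : n = servingBS N F s ω
    · exact Eventually.of_forall fun k hn' => absurd hn hn'
    · filter_upwards [(tendsto_gridAbove hr).eventually_lt_const (h.servingDist_lt hn)] with k hk _
      exact hk.le
  filter_upwards [hnear] with k hk
  rw [interference_eq_interferenceExcept, interferenceExcept, farInterference, sellerFar]
  congr 1
  refine tsum_congr fun n => ?_
  by_cases hn : n = servingBS N F s ω
  · have : ¬ gridAbove k r ≤ ‖F.bs s n ω‖ := by rw [hn]; exact (lt_gridAbove k r).not_ge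
    simp [hn ▸ this, hn]
  · have : gridAbove k r ≤ ‖F.bs s n ω‖ := by
      by_cases hlt : ‖F.bs s n ω‖ < r + 1
      · exact hk n hlt hn
      · exact (gridAbove_le_add_one k hr).trans (not_lt.1 hlt)
    simp [this, hn]

variable [MeasurableSpace Ω] {P : Measure Ω}

lemma IsModel.measurable_farFactor (hF : IsModel P N F s l x) (hs : s ∈ N.group l) (β t : ℝ) :
    Measurable (farFactor N F s l β t) :=
  measurable_expNeg.comp (measurable_const.mul (hF.measurable_farInterference hs t))

variable [IsProbabilityMeasure P]

lemma IsModel.measure_servingDist_Ici (hF : IsModel P N F s l x) (hs : s ∈ N.group l)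
    (hlam : 0 ≤ N.bsIntensity s) {r : ℝ} (hr : 0 ≤ r) :
    P (servingDist N F s ⁻¹' Ici r) =
      ENNReal.ofReal (Real.exp (-(N.bsIntensity s * (Real.pi * r ^ 2)))) := by
  have hX := hF.bs_poisson s hs
  calc P (servingDist N F s ⁻¹' Ici r) = P {ω | ∀ n, F.bs s n ω ∉ Metric.ball 0 r} := by
        refine measure_congr ?_
        filter_upwards [hX.ae_inGeneralPosition] with ω hω
        exact propext hω.forall_notMem_ball_iff.symm
    _ = ENNReal.ofReal (Real.exp (-(N.bsIntensity s * (Real.pi * r ^ 2)))) := by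
        rw [hX.measure_forall_notMem Metric.isOpen_ball.measurableSet,
          EuclideanSpace.volume_ball_fin_two, ← ENNReal.ofReal_pow hr,
          ← ENNReal.ofReal_mul (by positivity), ← ENNReal.ofReal_mul hlam,
          expNeg_ofReal (by positivity), mul_comm (r ^ 2)]

lemma IsModel.setLIntegral_Ici_farFactor (hF : IsModel P N F s l x) (hs : s ∈ N.sellers)
    (hl : l ∈ N.bands s) {β r t : ℝ} (hβ : 0 ≤ β) (hr : 0 ≤ r) (hrt : r ≤ t) (ht : 0 < t) :
    ∫⁻ ω in servingDist N F s ⁻¹' Ici r, farFactor N F s l β t ω ∂P =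
      P (servingDist N F s ⁻¹' Ici r) *
        ENNReal.ofReal (laplaceFormula P N F s l x β (laplaceArgument N β t)) := by
  have hmem := N.seller_mem_group s hs l hl
  have hlam : ∀ k ∈ N.group l, 0 ≤ N.bsIntensity k := fun _ hk =>
    (N.bsIntensity_pos_of_mem_group hs hl hk).le
  have hX := hF.bs_poisson s hmem
  have hθ := laplaceArgument_nonneg (N := N) hβ ht.le
  have hlaplace := hF.lintegral_void_mul_expNeg_farInterference hmem hlam
    (N.ueIntensity_pos_of_mem_sellers hs) (N.threshold_pos s hs) hθ hr hrt
  rw [sq_div_laplaceArgument_mul_sellerPower_rpow hβ ht, ← rho,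
    Real.mul_rpow hθ N.sellerPower_pos.le] at hlaplace
  have hvoid : ∫⁻ ω in servingDist N F s ⁻¹' Ici r, farFactor N F s l β t ω ∂P =
      ∫⁻ ω, {ω | ∀ n, F.bs s n ω ∉ Metric.ball 0 r}.indicator 1 ω * farFactor N F s l β t ω ∂P := by
    rw [← lintegral_indicator (measurable_servingDist hX.measurable measurableSet_Ici)]
    refine lintegral_congr_ae ?_
    filter_upwards [hX.ae_inGeneralPosition] with ω hω
    have hiff := hω.forall_notMem_ball_iff (N := N) (r := r)
    by_cases hr' : r ≤ servingDist N F s ω <;> simp only [indicator, mem_preimage, mem_Ici,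
      mem_ofPred_eq, hiff, hr', if_true, if_false, Pi.one_apply, one_mul, zero_mul]
  refine hvoid.trans (hlaplace.trans ?_)
  rw [hF.measure_servingDist_Ici hmem (hlam s hmem) hr, laplaceFormula,
    ← ENNReal.ofReal_mul (Real.exp_pos _).le]
  congr 5
  ring

lemma IsModel.setLIntegral_Ico_farFactor (hF : IsModel P N F s l x) (hs : s ∈ N.sellers)
    (hl : l ∈ N.bands s) {β r t : ℝ} (hβ : 0 ≤ β) (hr : 0 ≤ r) (hrt : r ≤ t) (ht : 0 < t) :
    ∫⁻ ω in servingDist N F s ⁻¹' Ico r t, farFactor N F s l β t ω ∂P =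
      P (servingDist N F s ⁻¹' Ico r t) *
        ENNReal.ofReal (laplaceFormula P N F s l x β (laplaceArgument N β t)) := by
  have hD := measurable_servingDist (N := N)
    (hF.bs_poisson s (N.seller_mem_group s hs l hl)).measurable
  have hdisj : Disjoint (servingDist N F s ⁻¹' Ico r t) (servingDist N F s ⁻¹' Ici t) :=
    Disjoint.preimage _ (Set.disjoint_left.2 fun _ h h' => h.2.not_ge h')
  have h := hF.setLIntegral_Ici_farFactor hs hl hβ hr hrt ht
  rw [← Ico_union_Ici_eq_Ici hrt, preimage_union, lintegral_union (hD measurableSet_Ici) hdisj,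
    measure_union hdisj (hD measurableSet_Ici), add_mul,
    hF.setLIntegral_Ici_farFactor hs hl hβ ht.le le_rfl ht] at h
  exact (ENNReal.add_left_inj
    (ENNReal.mul_ne_top (measure_ne_top _ _) ENNReal.ofReal_ne_top)).1 h

lemma IsModel.lintegral_gridAbove (hF : IsModel P N F s l x) (hs : s ∈ N.sellers)
    (hl : l ∈ N.bands s) {β : ℝ} (hβ : 0 ≤ β) (φ : ℝ → ℝ≥0∞) (k : ℕ) :
    ∫⁻ ω, φ (gridAbove k (servingDist N F s ω)) *
        farFactor N F s l β (gridAbove k (servingDist N F s ω)) ω ∂P =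
      ∫⁻ ω, φ (gridAbove k (servingDist N F s ω)) * ENNReal.ofReal (laplaceFormula P N F s l x β
        (laplaceArgument N β (gridAbove k (servingDist N F s ω)))) ∂P := by
  have hmem := N.seller_mem_group s hs l hl
  have hk : (0 : ℝ) < k + 1 := by positivity
  let J : Ω → ℕ := fun ω => ⌊servingDist N F s ω * ((k : ℝ) + 1)⌋₊
  have hJ : Measurable J := (measurable_gridIndex k).comp
    (measurable_servingDist (hF.bs_poisson s hmem).measurable)
  let t : ℕ → ℝ := fun j => ((j : ℝ) + 1) / (k + 1)
  have hcell : ∀ j, J ⁻¹' {j} = servingDist N F s ⁻¹' Ico (j / (k + 1)) (t j) := fun j => by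
    ext ω
    rw [mem_preimage, mem_singleton_iff, Nat.floor_eq_iff (mul_nonneg (servingDist_nonneg ω) hk.le),
      mem_preimage, mem_Ico, div_le_iff₀ hk, lt_div_iff₀ hk]
  refine (lintegral_comp_nat hJ fun j ω => φ (t j) * farFactor N F s l β (t j) ω).trans
    (Eq.trans (tsum_congr fun j => ?_) (lintegral_comp_nat hJ fun j _ => φ (t j) *
      ENNReal.ofReal (laplaceFormula P N F s l x β (laplaceArgument N β (t j)))).symm)
  have hjt : (j : ℝ) / (k + 1) ≤ t j := div_le_div_of_nonneg_right (by linarith) hk.le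
  rw [lintegral_const_mul _ (hF.measurable_farFactor hmem β (t j)), hcell,
    hF.setLIntegral_Ico_farFactor hs hl hβ (by positivity) hjt (by positivity), setLIntegral_const]
  ring

lemma IsModel.ae_tendsto_farFactor_gridAbove (hF : IsModel P N F s l x) (hs : s ∈ N.sellers)
    (hl : l ∈ N.bands s) (β : ℝ) :
    ∀ᵐ ω ∂P, Tendsto (fun k => farFactor N F s l β (gridAbove k (servingDist N F s ω)) ω) atTop
      (𝓝 (expNeg (ENNReal.ofReal (laplaceArgument N β (servingDist N F s ω)) *
        interference N F s l ω))) := by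
  filter_upwards [(hF.bs_poisson s (N.seller_mem_group s hs l hl)).ae_inGeneralPosition,
    hF.ae_interference_lt_top hs hl] with ω hω hfinite
  have hlim := ((continuous_laplaceArgument N β).tendsto _).comp
    (tendsto_gridAbove (servingDist_nonneg (N := N) (F := F) (s := s) ω))
  refine ((continuous_expNeg.tendsto _).comp (ENNReal.Tendsto.mul_const
    (ENNReal.tendsto_ofReal hlim) (Or.inr hfinite.ne))).congr' ?_
  filter_upwards [hω.eventually_farInterference_gridAbove (N := N) (l := l)] with k hk
  simp only [Function.comp_apply, farFactor, hk]

lemma IsModel.lintegral_boundedContinuous_mul_expNeg (hF : IsModel P N F s l x)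
    (hs : s ∈ N.sellers) (hl : l ∈ N.bands s) {β : ℝ} (hβ : 0 ≤ β)
    (φ : BoundedContinuousFunction ℝ ℝ≥0) :
    ∫⁻ ω, φ (servingDist N F s ω) * expNeg (ENNReal.ofReal
        (laplaceArgument N β (servingDist N F s ω)) * interference N F s l ω) ∂P =
      ∫⁻ ω, φ (servingDist N F s ω) * ENNReal.ofReal (laplaceFormula P N F s l x β
        (laplaceArgument N β (servingDist N F s ω))) ∂P := by
  have hmem := N.seller_mem_group s hs l hl
  have hD := measurable_servingDist (N := N) (hF.bs_poisson s hmem).measurable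
  have hL := (continuous_laplaceFormula P N F s l x β).comp (continuous_laplaceArgument N β)
  have hfar : ∀ k, Measurable fun ω => farFactor N F s l β (gridAbove k (servingDist N F s ω)) ω :=
    fun k => measurable_comp_nat ((measurable_gridIndex k).comp hD)
      (g := fun j => farFactor N F s l β ((j + 1) / (k + 1)))
      fun j => hF.measurable_farFactor hmem β _
  have hleft := tendsto_lintegral_gridAbove_mul hD servingDist_nonneg φ hfar
    (fun _ _ => expNeg_le_one _) (hF.ae_tendsto_farFactor_gridAbove hs hl β)
  have hright := tendsto_lintegral_gridAbove_mul (P := P) hD servingDist_nonneg φ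
    (f := fun k ω => ENNReal.ofReal (laplaceFormula P N F s l x β
      (laplaceArgument N β (gridAbove k (servingDist N F s ω)))))
    (fun k => (hL.measurable.comp ((measurable_gridAbove k).comp hD)).ennreal_ofReal)
    (fun k ω => ENNReal.ofReal_le_one.2 (hF.laplaceFormula_le_one hs hl hβ (laplaceArgument_nonneg
      hβ ((servingDist_nonneg ω).trans (lt_gridAbove k _).le))))
    (ae_of_all _ fun ω => ENNReal.tendsto_ofReal
      ((hL.tendsto _).comp (tendsto_gridAbove (servingDist_nonneg ω))))
  rw [funext (hF.lintegral_gridAbove hs hl hβ fun r => (φ r : ℝ≥0∞))] at hleft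
  exact tendsto_nhds_unique hleft hright

end FarFactor

/-! ### The Laplace transform of the interference given the serving distance -/

section ConditionalLaplace

lemma lintegral_comp_mul_eq_of_forall_boundedContinuous {Ω E : Type*} [MeasurableSpace Ω]
    {P : Measure Ω} [TopologicalSpace E] [MeasurableSpace E] [BorelSpace E] [HasOuterApproxClosed E]
    {D : Ω → E} (hD : Measurable D) {f g : Ω → ℝ≥0∞} (hf : Measurable f) (hg : Measurable g)
    (hfin : ∫⁻ ω, f ω ∂P ≠ ∞)
    (h : ∀ φ : BoundedContinuousFunction E ℝ≥0,
      ∫⁻ ω, φ (D ω) * f ω ∂P = ∫⁻ ω, φ (D ω) * g ω ∂P) {ψ : E → ℝ≥0∞} (hψ : Measurable ψ) :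
    ∫⁻ ω, ψ (D ω) * f ω ∂P = ∫⁻ ω, ψ (D ω) * g ω ∂P := by
  have hmap : ∀ {u : Ω → ℝ≥0∞}, Measurable u → ∀ {χ : E → ℝ≥0∞}, Measurable χ →
      ∫⁻ r, χ r ∂((P.withDensity u).map D) = ∫⁻ ω, χ (D ω) * u ω ∂P := fun {u} hu {χ} hχ => by
    rw [lintegral_map hχ hD, lintegral_withDensity_eq_lintegral_mul _ hu
      (g := fun ω => χ (D ω)) (hχ.comp hD)]
    exact lintegral_congr fun ω => mul_comm _ _
  have := isFiniteMeasure_withDensity hfin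
  have heq : (P.withDensity f).map D = (P.withDensity g).map D := by
    refine ext_of_forall_lintegral_eq_of_IsFiniteMeasure fun φ => ?_
    have hφ : Measurable fun r => (φ r : ℝ≥0∞) := φ.continuous.measurable.coe_nnreal_ennreal
    rw [hmap hf hφ, hmap hg hφ, h φ]
  rw [← hmap hf hψ, ← hmap hg hψ, heq]

lemma condExp_comap_ae_eq {Ω E : Type*} [MeasurableSpace Ω] {P : Measure Ω} [IsFiniteMeasure P]
    [mE : MeasurableSpace E] {D : Ω → E} (hD : Measurable D) {f : Ω → ℝ} (hf : Integrable f P)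
    (hf0 : ∀ ω, 0 ≤ f ω) {g : E → ℝ} (hg : Measurable g) (hg0 : ∀ r, 0 ≤ g r)
    (h : ∀ ψ : E → ℝ≥0∞, Measurable ψ → ∫⁻ ω, ψ (D ω) * ENNReal.ofReal (f ω) ∂P =
      ∫⁻ ω, ψ (D ω) * ENNReal.ofReal (g (D ω)) ∂P) :
    P[f | mE.comap D] =ᵐ[P] fun ω => g (D ω) := by
  have hgD : Measurable fun ω => g (D ω) := hg.comp hD
  have hgint : Integrable (fun ω => g (D ω)) P := by
    have hone := h 1 measurable_one
    simp only [Pi.one_apply, one_mul] at hone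
    rw [← lintegral_ofReal_ne_top_iff_integrable hgD.aestronglyMeasurable
      (ae_of_all _ fun ω => hg0 _), ← hone]
    exact (lintegral_ofReal_ne_top_iff_integrable hf.1 (ae_of_all _ hf0)).2 hf
  symm
  refine ae_eq_condExp_of_forall_setIntegral_eq hD.comap_le hf (fun _ _ _ => hgint.integrableOn)
    ?_ (hg.comp (comap_measurable D)).aestronglyMeasurable
  rintro _ ⟨S, hS, rfl⟩ -
  have htest : ∀ u : Ω → ℝ≥0∞,
      ∫⁻ ω in D ⁻¹' S, u ω ∂P = ∫⁻ ω, S.indicator 1 (D ω) * u ω ∂P := fun u => by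
    rw [← lintegral_indicator (hD hS)]
    exact lintegral_congr fun ω => by by_cases hω : D ω ∈ S <;> simp [hω]
  rw [integral_eq_lintegral_of_nonneg_ae (ae_of_all _ fun ω => hg0 _) hgD.aestronglyMeasurable,
    integral_eq_lintegral_of_nonneg_ae (ae_of_all _ hf0) hf.1.restrict, htest, htest,
    h _ (measurable_one.indicator hS)]

variable {MNO Band Ω : Type*} [DecidableEq MNO] {N : Network MNO Band} {F : Randomness MNO Band Ω}
  {s : MNO} {l : Band} {x : Plane} [MeasurableSpace Ω] {P : Measure Ω} [IsProbabilityMeasure P]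

lemma IsModel.lintegral_mul_expNeg (hF : IsModel P N F s l x) (hs : s ∈ N.sellers)
    (hl : l ∈ N.bands s) {β : ℝ} (hβ : 0 ≤ β) {ψ : ℝ → ℝ≥0∞} (hψ : Measurable ψ) :
    ∫⁻ ω, ψ (servingDist N F s ω) * expNeg (ENNReal.ofReal
        (laplaceArgument N β (servingDist N F s ω)) * interference N F s l ω) ∂P =
      ∫⁻ ω, ψ (servingDist N F s ω) * ENNReal.ofReal (laplaceFormula P N F s l x β
        (laplaceArgument N β (servingDist N F s ω))) ∂P := by
  have hmem := N.seller_mem_group s hs l hl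
  have hD := measurable_servingDist (N := N) (hF.bs_poisson s hmem).measurable
  have hκ := (continuous_laplaceArgument N β).measurable
  have hL := (continuous_laplaceFormula P N F s l x β).measurable
  refine lintegral_comp_mul_eq_of_forall_boundedContinuous hD
    (measurable_expNeg.comp ((hκ.comp hD).ennreal_ofReal.mul (hF.measurable_interference hmem)))
    (hL.comp (hκ.comp hD)).ennreal_ofReal (ne_top_of_le_ne_top ENNReal.one_ne_top ?_)
    (hF.lintegral_boundedContinuous_mul_expNeg hs hl hβ) hψ
  simpa using lintegral_mono (μ := P) fun ω => expNeg_le_one _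

theorem IsModel.condExp_exp_interference (hF : IsModel P N F s l x) (hs : s ∈ N.sellers)
    (hl : l ∈ N.bands s) {β : ℝ} (hβ : 0 ≤ β) :
    P[fun ω => Real.exp (-(laplaceArgument N β (servingDist N F s ω) *
          (interference N F s l ω).toReal))
        | MeasurableSpace.comap (servingDist N F s) inferInstance]
      =ᵐ[P] fun ω => laplaceFormula P N F s l x β (laplaceArgument N β (servingDist N F s ω)) := by
  have hmem := N.seller_mem_group s hs l hl
  have hD := measurable_servingDist (N := N) (hF.bs_poisson s hmem).measurable
  have hκ := (continuous_laplaceArgument N β).measurable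
  have hκ0 : ∀ ω, 0 ≤ laplaceArgument N β (servingDist N F s ω) := fun ω =>
    laplaceArgument_nonneg hβ (servingDist_nonneg ω)
  have hf : Measurable fun ω => Real.exp (-(laplaceArgument N β (servingDist N F s ω) *
      (interference N F s l ω).toReal)) :=
    ((hκ.comp hD).mul (hF.measurable_interference hmem).ennreal_toReal).neg.exp
  refine condExp_comap_ae_eq hD (Integrable.of_bound hf.aestronglyMeasurable 1
    (ae_of_all _ fun ω => ?_)) (fun ω => (Real.exp_pos _).le)
    ((continuous_laplaceFormula P N F s l x β).measurable.comp hκ)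
    (fun r => laplaceFormula_nonneg β _) fun ψ hψ =>
      Eq.trans (lintegral_congr_ae ?_) (hF.lintegral_mul_expNeg hs hl hβ hψ)
  · rw [Real.norm_of_nonneg (Real.exp_pos _).le, Real.exp_le_one_iff, neg_nonpos]
    exact mul_nonneg (hκ0 ω) ENNReal.toReal_nonneg
  · filter_upwards [hF.ae_interference_lt_top hs hl] with ω hI
    rw [expNeg_eq_ofReal_exp (ENNReal.mul_ne_top ENNReal.ofReal_ne_top hI.ne), ENNReal.toReal_mul,
      ENNReal.toReal_ofReal (hκ0 ω)]

end ConditionalLaplace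

/-! ### The serving distance and the gain of the serving base station -/

section ServingDistanceLaw

lemma expMeasure_Ici {r z : ℝ} (hr : 0 < r) (hz : 0 ≤ z) :
    expMeasure r (Ici z) = ENNReal.ofReal (Real.exp (-(r * z))) := by
  have hIoi : Ioi z = {h | ENNReal.ofReal z < ENNReal.ofReal h} := by
    ext h
    exact (ENNReal.ofReal_lt_ofReal_iff_of_nonneg hz).symm
  have hac : expMeasure r ≪ volume := withDensity_absolutelyContinuous _ _
  rw [measure_congr (hac.ae_eq Ioi_ae_eq_Ici).symm, hIoi, expMeasure_setOf_lt_ofReal hr,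
    ← ENNReal.ofReal_mul hr.le, expNeg_ofReal (mul_nonneg hr.le hz)]

lemma eq_expMeasure_of_measure_Ici {r : ℝ} (hr : 0 < r) {μ : Measure ℝ} [IsProbabilityMeasure μ]
    (h : ∀ z, 0 ≤ z → μ (Ici z) = ENNReal.ofReal (Real.exp (-(r * z)))) : μ = expMeasure r := by
  have := isProbabilityMeasure_expMeasure hr
  refine Measure.ext_of_Ici _ _ fun z => ?_
  rcases le_or_gt 0 z with hz | hz
  · rw [h z hz, expMeasure_Ici hr hz]
  · have hone : ∀ ν : Measure ℝ, IsProbabilityMeasure ν → ν (Ici 0) = 1 → ν (Ici z) = 1 :=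
      fun ν _ hν => le_antisymm prob_le_one (hν ▸ measure_mono (Ici_subset_Ici.2 hz.le))
    rw [hone μ inferInstance (by simp [h 0 le_rfl]),
      hone (expMeasure r) this (by simp [expMeasure_Ici hr le_rfl])]

variable {MNO Band Ω : Type*} [DecidableEq MNO] {N : Network MNO Band} {F : Randomness MNO Band Ω}
  {s : MNO} {l : Band} {x : Plane} [MeasurableSpace Ω] {P : Measure Ω} [IsProbabilityMeasure P]

lemma IsModel.map_sq_servingDist (hF : IsModel P N F s l x) (hs : s ∈ N.group l)
    (hlam : 0 < N.bsIntensity s) {c : ℝ} (hc : 0 < c) :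
    P.map (fun ω => servingDist N F s ω ^ 2 / c) =
      expMeasure (Real.pi * N.bsIntensity s * c) := by
  have hm : Measurable fun ω => servingDist N F s ω ^ 2 / c :=
    ((measurable_servingDist (hF.bs_poisson s hs).measurable).pow_const 2).div_const c
  have := Measure.isProbabilityMeasure_map (μ := P) hm.aemeasurable
  refine eq_expMeasure_of_measure_Ici (by positivity) fun z hz => ?_
  have hpre : (fun ω => servingDist N F s ω ^ 2 / c) ⁻¹' Ici z =
      servingDist N F s ⁻¹' Ici (Real.sqrt (z * c)) := by
    ext ω
    rw [mem_preimage, mem_Ici, le_div_iff₀ hc, mem_preimage, mem_Ici,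
      Real.sqrt_le_left (servingDist_nonneg ω)]
  rw [Measure.map_apply hm measurableSet_Ici, hpre,
    hF.measure_servingDist_Ici hs hlam.le (Real.sqrt_nonneg _), Real.sq_sqrt (by positivity)]
  ring_nf

end ServingDistanceLaw

section ServingGain

lemma measure_setOf_mem_comp_nat {Ω : Type*} [MeasurableSpace Ω] {P : Measure Ω} {J : Ω → ℕ}
    (hJ : Measurable J) {S : ℕ → Set Ω} (hS : ∀ n, MeasurableSet (S n)) :
    P {ω | ω ∈ S (J ω)} = ∑' n, P (J ⁻¹' {n} ∩ S n) := by
  have hSJ : MeasurableSet {ω | ω ∈ S (J ω)} := by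
    convert MeasurableSet.iUnion fun n => (hJ (measurableSet_singleton n)).inter (hS n) using 1
    ext ω
    simp
  rw [← lintegral_indicator_one hSJ]
  refine (lintegral_comp_nat hJ fun n => (S n).indicator 1).trans (tsum_congr fun n => ?_)
  rw [lintegral_indicator_one (hS n), Measure.restrict_apply (hS n), inter_comm]

lemma measure_inter_lt_ofReal_of_indep {Ω : Type*} {𝓐 mΩ : MeasurableSpace Ω} {P : Measure Ω}
    [IsProbabilityMeasure P] (h𝓐 : 𝓐 ≤ mΩ) {h : Ω → ℝ} (hh : Measurable h)
    (hlaw : P.map h = expMeasure 1) (hindep : Indep (MeasurableSpace.comap h inferInstance) 𝓐 P)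
    {T : Set Ω} (hT : MeasurableSet[𝓐] T) {a : Ω → ℝ≥0∞} (ha : Measurable[𝓐] a) :
    P (T ∩ {ω | a ω < ENNReal.ofReal (h ω)}) = ∫⁻ ω in T, expNeg (a ω) ∂P := by
  let U : Set (Ω × ℝ) := {q | q.1 ∈ T ∧ a q.1 < ENNReal.ofReal q.2}
  have hU : MeasurableSet[𝓐.prod inferInstance] U :=
    @MeasurableSet.inter _ (𝓐.prod inferInstance) _ _ (measurable_fst hT)
      (measurableSet_lt (ha.comp measurable_fst) measurable_snd.ennreal_ofReal)
  have hsection : ∀ ω, ∫⁻ m, U.indicator 1 (ω, m) ∂(expMeasure 1) =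
      T.indicator (fun ω => expNeg (a ω)) ω := fun ω => by
    by_cases hω : ω ∈ T
    · have hset : MeasurableSet {m : ℝ | a ω < ENNReal.ofReal m} :=
        measurableSet_lt measurable_const ENNReal.measurable_ofReal
      have := expMeasure_setOf_lt_ofReal one_pos (a ω)
      rw [ENNReal.ofReal_one, one_mul, ← lintegral_indicator_one hset] at this
      simpa [U, hω, indicator] using this
    · simp [U, hω]
  have hV : MeasurableSet (T ∩ {ω | a ω < ENNReal.ofReal (h ω)}) :=
    (h𝓐 _ hT).inter (measurableSet_lt (ha.mono h𝓐 le_rfl) hh.ennreal_ofReal)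
  rw [← lintegral_indicator_one hV, ← lintegral_indicator (h𝓐 _ hT), ← lintegral_congr hsection,
    ← hlaw]
  exact lintegral_comp_of_indep h𝓐 hh hindep
    ((@measurable_indicator_const_iff _ _ U (𝓐.prod inferInstance) _ _ _ 1 _).2 hU)

variable {MNO Band Ω : Type*} [DecidableEq MNO] {N : Network MNO Band} {F : Randomness MNO Band Ω}
  {s : MNO} {l : Band} {x : Plane}

/-- The σ-algebra of all the sources of randomness but the gain of BS number `n` of the seller. -/
@[reducible] def otherSigma (N : Network MNO Band) (F : Randomness MNO Band Ω) {s : MNO} {l : Band}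
    (hs : s ∈ N.group l) (n : ℕ) : MeasurableSpace Ω :=
  ⨆ i ∈ ({.gain ⟨s, hs⟩ n}ᶜ : Set (Source N s l)), Source.sigma F i

lemma measurable_bs_otherSigma (hs : s ∈ N.group l) (n : ℕ) {k : MNO} (hk : k ∈ N.group l)
    (m : ℕ) : Measurable[otherSigma N F hs n] (F.bs k m) :=
  (measurable_pointSigma (F.bs k) m).mono
    (Source.sigma_le_iSup (i := (.bs ⟨k, hk⟩ : Source N s l)) (by simp)) le_rfl

lemma measurable_gain_otherSigma (hs : s ∈ N.group l) {n m : ℕ} (h : m ≠ n) :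
    Measurable[otherSigma N F hs n] (F.gain l s m) :=
  (comap_measurable (F.gain l s m)).mono
    (Source.sigma_le_iSup (i := (.gain ⟨s, hs⟩ m : Source N s l)) (by simpa using h)) le_rfl

lemma measurable_buyerMark_otherSigma (hs : s ∈ N.group l) (n : ℕ) {b : MNO}
    (hb : b ∈ (N.group l).erase s) (m : ℕ) :
    Measurable[otherSigma N F hs n] (buyerMark F l b m) := by
  obtain ⟨hbs, hb'⟩ := Finset.mem_erase.1 hb
  exact measurable_iff_comap_le.2 (comap_buyerMark_le
    (Source.sigma_le_iSup (i := (.power ⟨b, hb⟩ m : Source N s l)) (by simp))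
    (Source.sigma_le_iSup (i := (.gain ⟨b, hb'⟩ m : Source N s l)) (by simp [hbs])))

lemma measurable_interferenceExcept_otherSigma (hs : s ∈ N.group l) (n : ℕ) :
    Measurable[otherSigma N F hs n] (interferenceExcept N F s l n) :=
  measurable_interferenceExcept (measurable_bs_otherSigma hs n hs)
    (fun _ hm => measurable_gain_otherSigma hs hm)
    fun _ hb => measurable_buyerInterference
      (measurable_bs_otherSigma hs n (Finset.mem_of_mem_erase hb))
      (measurable_buyerMark_otherSigma hs n hb)

variable [MeasurableSpace Ω] {P : Measure Ω}

lemma IsModel.otherSigma_le (hF : IsModel P N F s l x) (hs : s ∈ N.group l) (n : ℕ) :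
    otherSigma N F hs n ≤ ‹MeasurableSpace Ω› :=
  iSup₂_le fun i _ => hF.source_le i

lemma IsModel.gain_indep_otherSigma (hF : IsModel P N F s l x) (hs : s ∈ N.group l) (n : ℕ) :
    Indep (MeasurableSpace.comap (F.gain l s n) inferInstance) (otherSigma N F hs n) P :=
  have hdisj : Disjoint ({.gain ⟨s, hs⟩ n} : Set (Source N s l)) {.gain ⟨s, hs⟩ n}ᶜ :=
    disjoint_compl_right
  indep_of_indep_of_le_left (indep_iSup_of_disjoint hF.source_le hF.indep hdisj)
    (Source.sigma_le_iSup (F := F) (mem_singleton (.gain ⟨s, hs⟩ n : Source N s l)))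

-- The serving BS is random, so its gain is integrated out on each event that it has number `n`:
-- that event and everything else in the SINR are independent of the gain of BS number `n`.
lemma IsModel.measure_lt_servingGain [IsProbabilityMeasure P] (hF : IsModel P N F s l x)
    (hs : s ∈ N.group l) {κ : ℝ → ℝ≥0∞} (hκ : Measurable κ) (c : ℝ≥0∞) :
    P {ω | κ (servingDist N F s ω) * (interference N F s l ω + c) <
        ENNReal.ofReal (F.gain l s (servingBS N F s ω) ω)} =
      ∫⁻ ω, expNeg (κ (servingDist N F s ω) * (interference N F s l ω + c)) ∂P := by
  have hJ := measurable_servingBS (N := N) (hF.bs_poisson s hs).measurable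
  let a : ℕ → Ω → ℝ≥0∞ := fun n ω =>
    κ (servingDist N F s ω) * (interferenceExcept N F s l n ω + c)
  have ha : ∀ n, Measurable[otherSigma N F hs n] (a n) := fun n =>
    (hκ.comp (measurable_servingDist (measurable_bs_otherSigma hs n hs))).mul
      ((measurable_interferenceExcept_otherSigma hs n).add_const c)
  have hcell : ∀ n, MeasurableSet[otherSigma N F hs n] (servingBS N F s ⁻¹' {n}) := fun n =>
    measurable_servingBS (measurable_bs_otherSigma hs n hs) (measurableSet_singleton n)
  have hlt : ∀ n, MeasurableSet {ω | a n ω < ENNReal.ofReal (F.gain l s n ω)} := fun n =>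
    measurableSet_lt ((ha n).mono (hF.otherSigma_le hs n) le_rfl)
      (hF.gain_measurable s hs n).ennreal_ofReal
  simp only [interference_eq_interferenceExcept]
  calc P {ω | a (servingBS N F s ω) ω < ENNReal.ofReal (F.gain l s (servingBS N F s ω) ω)}
      = ∑' n, P (servingBS N F s ⁻¹' {n} ∩ {ω | a n ω < ENNReal.ofReal (F.gain l s n ω)}) :=
        measure_setOf_mem_comp_nat hJ hlt
    _ = ∑' n, ∫⁻ ω in servingBS N F s ⁻¹' {n}, expNeg (a n ω) ∂P := tsum_congr fun n =>
        measure_inter_lt_ofReal_of_indep (hF.otherSigma_le hs n) (hF.gain_measurable s hs n)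
          (hF.gain_law s hs n) (hF.gain_indep_otherSigma hs n) (hcell n) (ha n)
    _ = ∫⁻ ω, expNeg (a (servingBS N F s ω) ω) ∂P :=
        (lintegral_comp_nat hJ fun n ω => expNeg (a n ω)).symm

end ServingGain

/-! ### The coverage probability -/

section Coverage

lemma ofReal_lt_ofReal_div_iff {α β p h r : ℝ} (hβ : 0 < β) (hp : 0 < p) (hh : 0 ≤ h) (hr : 0 < r)
    (S : ℝ≥0∞) :
    ENNReal.ofReal β < ENNReal.ofReal (p * h * r ^ (-α)) / S ↔
      ENNReal.ofReal (β * r ^ α / p) * S < ENNReal.ofReal h := by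
  have hc : 0 < p * r ^ (-α) := by positivity
  have hargument : β * r ^ α / p = β / (p * r ^ (-α)) := by
    rw [Real.rpow_neg hr.le]
    field_simp
  have hβ' : ENNReal.ofReal β ≠ 0 := by simpa using hβ
  rw [ENNReal.lt_div_iff_mul_lt (Or.inr ENNReal.ofReal_ne_top) (Or.inr hβ'), hargument,
    mul_right_comm, mul_comm _ h, ENNReal.ofReal_mul hh, ENNReal.ofReal_div_of_pos hc,
    mul_comm (_ / _), ← mul_div_assoc, mul_comm S,
    ENNReal.div_lt_iff (Or.inl (by simpa using hc)) (Or.inl ENNReal.ofReal_ne_top)]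

lemma lintegral_expMeasure_eq_setLIntegral_Ioi {r : ℝ} {f : ℝ → ℝ≥0∞} (hf : Measurable f) :
    ∫⁻ z, f z ∂(expMeasure r) =
      ∫⁻ z in Ioi 0, ENNReal.ofReal (r * Real.exp (-(r * z))) * f z := by
  rw [lintegral_expMeasure hf, ← lintegral_indicator measurableSet_Ioi]
  have hne : ∀ᵐ z : ℝ, z ≠ 0 := by simp [ae_iff]
  refine lintegral_congr_ae ?_
  filter_upwards [hne] with z hz
  rcases hz.lt_or_gt with hneg | hpos
  · rw [exponentialPDF_of_neg hneg, zero_mul, indicator_of_notMem (notMem_Ioi.2 hneg.le)]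
  · rw [exponentialPDF_of_nonneg hpos.le, indicator_of_mem (mem_Ioi.2 hpos)]

variable {MNO Band Ω : Type*} [DecidableEq MNO] {N : Network MNO Band} {F : Randomness MNO Band Ω}
  {s : MNO} {l : Band} {x : Plane}

lemma laplaceArgument_eq_mul_rpow {r : ℝ} (β : ℝ) (hr : 0 ≤ r) :
    laplaceArgument N β r = β * (r ^ 2 / N.sellerPower ^ (2 / N.α)) ^ (N.α / 2) := by
  have hp := N.sellerPower_pos
  have hα : 2 / N.α * (N.α / 2) = 1 := by
    have := N.two_lt_α
    field_simp
  rw [laplaceArgument, mul_div_assoc, Real.div_rpow (by positivity) (by positivity),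
    ← Real.rpow_mul hp.le, hα, Real.rpow_one, ← Real.rpow_natCast, ← Real.rpow_mul hr]
  congr 3
  push_cast
  ring

variable [MeasurableSpace Ω] {P : Measure Ω}

lemma IsModel.measurable_sinr (hF : IsModel P N F s l x) (hs : s ∈ N.group l) :
    Measurable (sinr N F s l) := by
  have hX := (hF.bs_poisson s hs).measurable
  refine Measurable.div (Measurable.ennreal_ofReal ?_)
    ((hF.measurable_interference hs).add_const _)
  exact (measurable_const.mul (measurable_comp_nat (measurable_servingBS hX)
    (hF.gain_measurable s hs))).mul ((measurable_servingDist hX).pow_const _)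

lemma coverageIntegrand_nonneg (hlam : 0 ≤ N.bsIntensity s) (β z : ℝ) :
    0 ≤ coverageIntegrand P N F s l x β z := by
  have hp := N.sellerPower_pos
  have hL : 0 ≤ laplaceFormula P N F s l x β (β * z ^ (N.α / 2)) := laplaceFormula_nonneg β _
  unfold coverageIntegrand
  positivity

lemma measurable_coverageIntegrand (P : Measure Ω) (N : Network MNO Band)
    (F : Randomness MNO Band Ω) (s : MNO) (l : Band) (x : Plane) (β : ℝ) :
    Measurable (coverageIntegrand P N F s l x β) := by
  have hL := (continuous_laplaceFormula P N F s l x β).measurable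
  unfold coverageIntegrand
  fun_prop

variable [IsProbabilityMeasure P]

lemma IsModel.coverage_eq (hF : IsModel P N F s l x) (hs : s ∈ N.group l) (β : ℝ) :
    coverage P N F s l β = P.real {ω | ENNReal.ofReal β < sinr N F s l ω} := by
  have hle : powerSigma N F s l ≤ ‹MeasurableSpace Ω› :=
    Measurable.comap_le (measurable_pi_lambda _ fun k => measurable_pi_lambda _ fun n =>
      hF.power_measurable k k.2 n)
  rw [coverage, integral_condExp hle, integral_indicator
    (measurableSet_lt measurable_const (hF.measurable_sinr hs))]
  simp

lemma IsModel.ae_lt_sinr_iff (hF : IsModel P N F s l x) (hs : s ∈ N.group l) {β : ℝ}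
    (hβ : 0 < β) : ∀ᵐ ω ∂P, ENNReal.ofReal β < sinr N F s l ω ↔
      ENNReal.ofReal (laplaceArgument N β (servingDist N F s ω)) *
        (interference N F s l ω + ENNReal.ofReal (N.σ ^ 2)) <
      ENNReal.ofReal (F.gain l s (servingBS N F s ω) ω) := by
  have hgain : ∀ᵐ ω ∂P, ∀ n, 0 < F.gain l s n ω := ae_all_iff.2 fun n =>
    ae_pos_of_map_eq_expMeasure one_pos (hF.gain_measurable s hs n) (hF.gain_law s hs n)
  filter_upwards [(hF.bs_poisson s hs).ae_inGeneralPosition, hgain] with ω hω hpos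
  exact ofReal_lt_ofReal_div_iff hβ N.sellerPower_pos (hpos _).le
    (norm_pos_iff.2 (hω.ne_zero _)) _

lemma IsModel.measure_lt_sinr_eq_lintegral (hF : IsModel P N F s l x) (hs : s ∈ N.sellers)
    (hl : l ∈ N.bands s) {β : ℝ} (hβ : 0 < β) :
    P {ω | ENNReal.ofReal β < sinr N F s l ω} =
      ∫⁻ ω, expNeg (ENNReal.ofReal (laplaceArgument N β (servingDist N F s ω)) *
          ENNReal.ofReal (N.σ ^ 2)) *
        ENNReal.ofReal (laplaceFormula P N F s l x β
          (laplaceArgument N β (servingDist N F s ω))) ∂P := by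
  have hmem := N.seller_mem_group s hs l hl
  have hκ := (continuous_laplaceArgument N β).measurable.ennreal_ofReal
  have hevent : P {ω | ENNReal.ofReal β < sinr N F s l ω} =
      P {ω | ENNReal.ofReal (laplaceArgument N β (servingDist N F s ω)) *
          (interference N F s l ω + ENNReal.ofReal (N.σ ^ 2)) <
        ENNReal.ofReal (F.gain l s (servingBS N F s ω) ω)} :=
    measure_congr ((hF.ae_lt_sinr_iff hmem hβ).mono fun ω hω => propext hω)
  rw [hevent, hF.measure_lt_servingGain hmem hκ, ← hF.lintegral_mul_expNeg hs hl hβ.le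
      (ψ := fun r => expNeg (ENNReal.ofReal (laplaceArgument N β r) * ENNReal.ofReal (N.σ ^ 2)))
      (measurable_expNeg.comp (hκ.mul_const _))]
  refine lintegral_congr fun ω => ?_
  rw [mul_add, expNeg_add, mul_comm]

lemma IsModel.measure_lt_sinr (hF : IsModel P N F s l x) (hs : s ∈ N.sellers)
    (hl : l ∈ N.bands s) {β : ℝ} (hβ : 0 < β) : P {ω | ENNReal.ofReal β < sinr N F s l ω} =
      ∫⁻ z in Ioi (0 : ℝ), ENNReal.ofReal (coverageIntegrand P N F s l x β z) := by
  have hmem := N.seller_mem_group s hs l hl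
  have hlam := N.bsIntensity_pos_of_mem_group hs hl hmem
  have hp := N.sellerPower_pos
  have hD := measurable_servingDist (N := N) (hF.bs_poisson s hmem).measurable
  let G : ℝ → ℝ≥0∞ := fun z =>
    expNeg (ENNReal.ofReal (β * z ^ (N.α / 2)) * ENNReal.ofReal (N.σ ^ 2)) *
      ENNReal.ofReal (laplaceFormula P N F s l x β (β * z ^ (N.α / 2)))
  have hG : Measurable G := by
    have hL := (continuous_laplaceFormula P N F s l x β).measurable
    fun_prop
  have hc : 0 < N.sellerPower ^ (2 / N.α) := Real.rpow_pos_of_pos hp _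
  rw [hF.measure_lt_sinr_eq_lintegral hs hl hβ]
  simp_rw [laplaceArgument_eq_mul_rpow β (servingDist_nonneg _)]
  rw [← lintegral_map hG ((hD.pow_const 2).div_const _), hF.map_sq_servingDist hmem hlam hc,
    lintegral_expMeasure_eq_setLIntegral_Ioi hG]
  refine setLIntegral_congr_fun measurableSet_Ioi fun z (hz : 0 < z) => ?_
  simp only [G]
  rw [← ENNReal.ofReal_mul (by positivity), expNeg_ofReal (by positivity),
    ← ENNReal.ofReal_mul (Real.exp_pos _).le, ← ENNReal.ofReal_mul (by positivity),
    coverageIntegrand]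
  ring_nf

end Coverage

end

end SpectrumSharing

open SpectrumSharing in
theorem theorem2 {MNO Band Ω : Type*} [DecidableEq MNO] [MeasurableSpace Ω]
    (P : Measure Ω) [IsProbabilityMeasure P]
    (N : Network MNO Band) (F : Randomness MNO Band Ω)
    (s : MNO) (hs : s ∈ N.sellers) (l : Band) (hl : l ∈ N.bands s)
    (x : Plane) (hF : IsModel P N F s l x)
    (β : ℝ) (hβ : 0 < β) :
    -- the power moment is finite, and so is the interference
    Integrable (fun ω => buyerPower N F s l x ω ^ (2 / N.α)) P ∧
    (∀ᵐ ω ∂P, interference N F s l ω < ∞) ∧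
    -- the Laplace transform of the interference given the serving distance `r`, at `β * r ^ α / Pˢ`
    (P[fun ω => Real.exp (-(β * servingDist N F s ω ^ N.α / N.sellerPower *
          (interference N F s l ω).toReal))
        | MeasurableSpace.comap (servingDist N F s) inferInstance]
      =ᵐ[P] fun ω => laplaceFormula P N F s l x β
        (β * servingDist N F s ω ^ N.α / N.sellerPower)) ∧
    -- the coverage probability
    IntegrableOn (coverageIntegrand P N F s l x β) (Ioi 0) ∧
    coverage P N F s l β = ∫ z in Ioi (0 : ℝ), coverageIntegrand P N F s l x β z := by
  have hmem := N.seller_mem_group s hs l hl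
  have hmeas := measurable_coverageIntegrand P N F s l x β
  have hnonneg : 0 ≤ᵐ[volume.restrict (Ioi 0)] coverageIntegrand P N F s l x β := ae_of_all _
    (coverageIntegrand_nonneg (N.bsIntensity_pos_of_mem_group hs hl hmem).le β)
  have hcov := hF.measure_lt_sinr hs hl hβ
  refine ⟨hF.integrable_buyerPower_rpow (N.ueIntensity_pos_of_mem_sellers hs)
    (N.threshold_pos s hs), hF.ae_interference_lt_top hs hl,
    hF.condExp_exp_interference hs hl hβ.le, ?_, ?_⟩
  · rw [IntegrableOn, ← lintegral_ofReal_ne_top_iff_integrable hmeas.aestronglyMeasurable hnonneg,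
      ← hcov]
    exact measure_ne_top _ _
  · rw [hF.coverage_eq hmem, measureReal_def, hcov,
      integral_eq_lintegral_of_nonneg_ae hnonneg hmeas.aestronglyMeasurable]
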